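/- Let $k$ be a field, $A=k[X_1,X_2,\ldots]=\bigcup_n k[X_1,\ldots,X_n]$ the polynomial ring in countably many variables, $d\ge 1$ an integer, and let $R=A^{(d)}$ be the $d$-th Veronese subring of $A$, i.e. the $k$-subalgebra of $A$ generated by all monomials of degree $d$. Then $R$ is Cohen–Macaulay in each of the senses (i)–(iv) below. Notation. $\operatorname{ht}$ denotes height (the infimum of the heights of the minimal primes; $\operatorname{ht}(R)=\infty$). For a finite sequence $\underline x=x_1,\ldots,x_\ell$ in a commutative ring $B$, let $\mathbb K_\bullet(\underline x)$ be its Koszul complex. If an ideal $\mathfrak b$ of $B$ is generated by $\underline x$, its Koszul grade on a $B$-module $M$ is $\operatorname{K.grade}_B(\mathfrak b,M)=\inf\{i\ge 0: H^i(\operatorname{Hom}_B(\mathbb K_\bullet(\underline x),M))\ne 0\}$ (this is independent of $\underline x$; $\inf\emptyset=\infty$), and for an arbitrary ideal $\mathfrak a$, $\operatorname{K.grade}_B(\mathfrak a,M)$ is the supremum of $\operatorname{K.grade}_B(\mathfrak b,M)$ over the finitely generated ideals $\mathfrak b\subseteq\mathfrak a$. (i) (Glaz) $\operatorname{ht}_R(\mathfrak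 p)=\operatorname{K.grade}_{R_{\mathfrak p}}(\mathfrak pR_{\mathfrak p},R_{\mathfrak p})$ for every prime ideal $\mathfrak p$ of $R$. (ii) (Weak Bourbaki unmixed) For every finitely generated ideal $\mathfrak a$ of $R$ whose height is at least the minimal number $\mu(\mathfrak a)$ of its generators, the set of minimal primes of $\mathfrak a$ equals the set of weakly associated primes of $R/\mathfrak a$, i.e. of the primes that are minimal over $(0:_R m)$ for some $m\in R/\mathfrak a$. (iii) (Hamilton–Marley) Every strong parameter sequence on $R$ is a regular sequence on $R$. Here $\underline x=x_1,\ldots,x_\ell$ is weakly proregular if for each $n>0$ there is $m\ge n$ such that the map $H_i(\mathbb K_\bullet(\underline x^m))\to H_i(\mathbb K_\bullet(\underline x^n))$ induced by $e_{j_1}\wedge\cdots\wedge e_{j_i}\mapsto (x_{j_1}\cdots x_{j_i})^{m-n}\,e_{j_1}\wedge\cdots\wedge e_{j_i}$ is zero for all $i\ge1$, where $\underline x^m=x_1^m,\ldots,x_\ell^m$; $\underline x$ is a parameter sequence on $R$ if it is weakly proregular, $(\underline x)R\ne R$, and the $\ell$-th cohomology $H^\ell_{\underline x}(R)$ of the Čech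 complex of $R$ with respect to $\underline x$ satisfies $H^\ell_{\underline x}(R)_{\mathfrak p}\ne0$ for every prime $\mathfrak p\supseteq(\underline x)R$; and $\underline x$ is a strong parameter sequence if $x_1,\ldots,x_i$ is a parameter sequence for all $1\le i\le\ell$. (iv) For every non-empty class $\mathcal A$ of ideals of $R$, $\operatorname{ht}_R(\mathfrak a)=\operatorname{K.grade}_R(\mathfrak a,R)$ for all $\mathfrak a\in\mathcal A$; in particular this holds for the classes of all prime ideals, all maximal ideals, all ideals and all finitely generated ideals. -/

import Mathlib

namespace CohenMacaulay

set_option linter.unusedSectionVars false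

universe u v w

section Signs

variable {ι : Type w} [LinearOrder ι]

/-- The sign `(-1) ^ #{a ∈ t | a < j}` attached to removing `j` from `t`. -/
def faceSign (R : Type u) [CommRing R] (t : Finset ι) (j : ι) : R :=
  (-1) ^ (t.filter (· < j)).card

lemma faceSign_swap_of_lt (R : Type u) [CommRing R] (t : Finset ι) {j l : ι} (hj : j ∈ t)
    (hjl : j < l) :
    faceSign R t j * faceSign R (t.erase j) l + faceSign R t l * faceSign R (t.erase l) j = 0 := by
  have h1 : (t.erase l).filter (· < j) = t.filter (· < j) := by
    ext a
    simp only [Finset.mem_filter, Finset.mem_erase]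
    constructor
    · rintro ⟨⟨_, h⟩, h'⟩
      exact ⟨h, h'⟩
    · rintro ⟨h, h'⟩
      exact ⟨⟨(h'.trans hjl).ne, h⟩, h'⟩
  have h2 : ((t.erase j).filter (· < l)).card + 1 = (t.filter (· < l)).card := by
    rw [Finset.filter_erase]
    exact Finset.card_erase_add_one (Finset.mem_filter.2 ⟨hj, hjl⟩)
  simp only [faceSign, h1, ← h2]
  ring

/-- Removing two elements in the two possible orders gives opposite signs. -/
lemma faceSign_swap (R : Type u) [CommRing R] (t : Finset ι) {j l : ι} (hj : j ∈ t)
    (hl : l ∈ t) (hjl : j ≠ l) :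
    faceSign R t j * faceSign R (t.erase j) l + faceSign R t l * faceSign R (t.erase l) j = 0 := by
  rcases lt_or_gt_of_ne hjl with h | h
  · exact faceSign_swap_of_lt R t hj h
  · rw [add_comm]
    exact faceSign_swap_of_lt R t hl h

/-- A double sum over the ordered pairs of distinct elements of `t` vanishes when exchanging the
two elements changes the sign of the summand. -/
lemma sum_erase_eq_zero {M : Type v} [AddCommGroup M] (t : Finset ι)
    (F : (j : t) → (t.erase j.1 : Finset ι) → M)
    (hF : ∀ (j : t) (l : (t.erase j.1 : Finset ι)),
      F j l + F ⟨l.1, Finset.mem_of_mem_erase l.2⟩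
        ⟨j.1, Finset.mem_erase.2 ⟨(Finset.ne_of_mem_erase l.2).symm, j.2⟩⟩ = 0) :
    ∑ j, ∑ l, F j l = 0 := by
  rw [← Fintype.sum_sigma']
  refine Finset.sum_involution
    (fun p _ => ⟨⟨p.2.1, Finset.mem_of_mem_erase p.2.2⟩,
      ⟨p.1.1, Finset.mem_erase.2 ⟨(Finset.ne_of_mem_erase p.2.2).symm, p.1.2⟩⟩⟩)
    (fun p _ => hF p.1 p.2) ?_ (fun _ _ => Finset.mem_univ _) (fun _ _ => rfl)
  intro p _ _ h
  exact Finset.ne_of_mem_erase p.2.2 (congrArg (fun q => q.1.1) h)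

end Signs

section Faces

variable {ι : Type w} [LinearOrder ι]

/-- The subsets of `ι` with exactly `i` elements. -/
abbrev Face (ι : Type w) (i : ℕ) : Type w := {s : Finset ι // s.card = i}

/-- The face of `t` obtained by removing the element `j`. -/
abbrev Face.erase {i : ℕ} (t : Face ι (i + 1)) (j : t.1) : Face ι i :=
  ⟨t.1.erase j.1, by rw [Finset.card_erase_of_mem j.2, t.2]; rfl⟩

end Faces

section Koszul

variable {R : Type u} [CommRing R] {ι : Type w} [LinearOrder ι]

/-- The `i`-th term of the Koszul complex: the free module on the symbols `e_s`, where `s` runs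
through the subsets of `ι` with `i` elements. -/
abbrev KoszulChain (R : Type u) [CommRing R] (ι : Type w) (i : ℕ) : Type (max w u) :=
  Face ι i →₀ R

/-- The Koszul differential
`∂ e_t = ∑_{j ∈ t} (-1) ^ #{a ∈ t | a < j} x_j e_{t \ {j}}`. -/
noncomputable def koszulD (x : ι → R) (i : ℕ) :
    KoszulChain R ι (i + 1) →ₗ[R] KoszulChain R ι i :=
  Finsupp.linearCombination R fun t =>
    ∑ j : t.1, Finsupp.single (t.erase j) (faceSign R t.1 j.1 * x j.1)

lemma koszulD_single (x : ι → R) (i : ℕ) (t : Face ι (i + 1)) (r : R) :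
    koszulD x i (Finsupp.single t r) =
      ∑ j : t.1, Finsupp.single (t.erase j) (r * (faceSign R t.1 j.1 * x j.1)) := by
  rw [koszulD, Finsupp.linearCombination_single, Finset.smul_sum]
  exact Finset.sum_congr rfl fun j _ => by rw [Finsupp.smul_single, smul_eq_mul]

lemma koszulD_comp_koszulD (x : ι → R) (i : ℕ) : koszulD x i ∘ₗ koszulD x (i + 1) = 0 := by
  refine Finsupp.lhom_ext' fun t => LinearMap.ext_ring ?_
  simp only [LinearMap.comp_apply, Finsupp.lsingle_apply, koszulD_single, map_sum,
    LinearMap.zero_apply]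
  refine sum_erase_eq_zero t.1 _ fun j l => ?_
  have hs : (t.erase j).erase l = (t.erase ⟨l.1, Finset.mem_of_mem_erase l.2⟩).erase
      ⟨j.1, Finset.mem_erase.2 ⟨(Finset.ne_of_mem_erase l.2).symm, j.2⟩⟩ :=
    Subtype.ext Finset.erase_right_comm
  have h := faceSign_swap R t.1 j.2 (Finset.mem_of_mem_erase l.2)
    (Finset.ne_of_mem_erase l.2).symm
  refine (congrArg (fun s => Finsupp.single s _ + _) hs).trans
    ((Finsupp.single_add _ _ _).symm.trans (Finsupp.single_eq_zero.2 ?_))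
  linear_combination x j.1 * x l.1 * h

/-- The cycles of the Koszul complex in degree `i`. -/
noncomputable def koszulCycles (x : ι → R) : (i : ℕ) → Submodule R (KoszulChain R ι i)
  | 0 => ⊤
  | i + 1 => LinearMap.ker (koszulD x i)

/-- The Koszul homology `H_i(K_•(x))`, cycles modulo boundaries, realized as the image of the cycles
in the quotient of `K_i` by the boundaries. -/
abbrev KoszulHomology (x : ι → R) (i : ℕ) : Type (max w u) :=
  (koszulCycles x i).map (LinearMap.range (koszulD x i)).mkQ

/-- The map `K_•(x ^ m) → K_•(x ^ n)`, for `n ≤ m`, which is the tensor product over `j` of the maps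
`K_•(x_j ^ m) → K_•(x_j ^ n)` given by `1` in degree `0` and by `x_j ^ (m - n)` in degree `1`; that
is, `e_s ↦ (∏_{j ∈ s} x_j) ^ (m - n) e_s`. -/
noncomputable def koszulPowMap (x : ι → R) (m n i : ℕ) :
    KoszulChain R ι i →ₗ[R] KoszulChain R ι i :=
  Finsupp.linearCombination R fun s => Finsupp.single s ((∏ j ∈ s.1, x j) ^ (m - n))

lemma koszulPowMap_single (x : ι → R) (m n i : ℕ) (s : Face ι i) (r : R) :
    koszulPowMap x m n i (Finsupp.single s r) =
      Finsupp.single s (r * (∏ j ∈ s.1, x j) ^ (m - n)) := by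
  simp [koszulPowMap]

/-- `koszulPowMap` is a chain map. -/
lemma koszulD_comp_koszulPowMap (x : ι → R) {m n : ℕ} (h : n ≤ m) (i : ℕ) :
    koszulD (x ^ n) i ∘ₗ koszulPowMap x m n (i + 1) =
      koszulPowMap x m n i ∘ₗ koszulD (x ^ m) i := by
  refine Finsupp.lhom_ext' fun t => LinearMap.ext_ring ?_
  simp only [LinearMap.comp_apply, Finsupp.lsingle_apply, koszulD_single, koszulPowMap_single,
    map_sum]
  refine Finset.sum_congr rfl fun j _ => congrArg _ ?_
  simp only [Pi.pow_apply]
  rw [← Finset.mul_prod_erase t.1 x j.2, mul_pow, ← Nat.sub_add_cancel h, pow_add,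
    Nat.add_sub_cancel]
  ring

lemma koszulCycles_le_comap (x : ι → R) {m n : ℕ} (h : n ≤ m) (i : ℕ) :
    koszulCycles (x ^ m) i ≤ (koszulCycles (x ^ n) i).comap (koszulPowMap x m n i) := by
  cases i with
  | zero => exact fun _ _ => Submodule.mem_top
  | succ i =>
    intro z hz
    have hz' : koszulD (x ^ m) i z = 0 := hz
    change koszulD (x ^ n) i (koszulPowMap x m n (i + 1) z) = 0
    rw [← LinearMap.comp_apply, koszulD_comp_koszulPowMap x h, LinearMap.comp_apply, hz', map_zero]

lemma range_koszulD_le_comap (x : ι → R) {m n : ℕ} (h : n ≤ m) (i : ℕ) :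
    LinearMap.range (koszulD (x ^ m) i) ≤
      (LinearMap.range (koszulD (x ^ n) i)).comap (koszulPowMap x m n i) := by
  rintro _ ⟨y, rfl⟩
  exact ⟨koszulPowMap x m n (i + 1) y, LinearMap.congr_fun (koszulD_comp_koszulPowMap x h i) y⟩

/-- The map induced by `koszulPowMap` on Koszul homology,
`H_i(K_•(x ^ m)) → H_i(K_•(x ^ n))`. -/
noncomputable def koszulHomologyPowMap (x : ι → R) {m n : ℕ} (h : n ≤ m) (i : ℕ) :
    KoszulHomology (x ^ m) i →ₗ[R] KoszulHomology (x ^ n) i :=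
  (Submodule.mapQ _ _ (koszulPowMap x m n i) (range_koszulD_le_comap x h i)).restrict (by
    rintro _ ⟨z, hz, rfl⟩
    exact ⟨koszulPowMap x m n i z, koszulCycles_le_comap x h i hz, rfl⟩)

/-- `x` is weakly proregular: for each `n > 0` there is `m ≥ n` such that
`H_i(K_•(x ^ m)) → H_i(K_•(x ^ n))` is zero for all `i ≥ 1`. -/
def IsWeaklyProregular (x : ι → R) : Prop :=
  ∀ n : ℕ, 0 < n → ∃ (m : ℕ) (h : n ≤ m), ∀ i : ℕ, 1 ≤ i → koszulHomologyPowMap x h i = 0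

variable (M : Type v) [AddCommGroup M] [Module R M]

/-- The differential `Hom(K_i(x), M) → Hom(K_{i+1}(x), M)`, `f ↦ f ∘ ∂`. -/
noncomputable def koszulHomD (x : ι → R) (i : ℕ) :
    (KoszulChain R ι i →ₗ[R] M) →ₗ[R] (KoszulChain R ι (i + 1) →ₗ[R] M) :=
  LinearMap.lcomp R M (koszulD x i)

lemma koszulHomD_comp_koszulHomD (x : ι → R) (i : ℕ) :
    koszulHomD M x (i + 1) ∘ₗ koszulHomD M x i = 0 := by
  ext1 f
  change (f ∘ₗ koszulD x i) ∘ₗ koszulD x (i + 1) = 0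
  rw [LinearMap.comp_assoc, koszulD_comp_koszulD, LinearMap.comp_zero]

/-- The coboundaries of `Hom(K_•(x), M)` in degree `i`. -/
noncomputable def koszulCoboundaries (x : ι → R) :
    (i : ℕ) → Submodule R (KoszulChain R ι i →ₗ[R] M)
  | 0 => ⊥
  | i + 1 => LinearMap.range (koszulHomD M x i)

/-- The Koszul cohomology `H^i(Hom(K_•(x), M))`, cocycles modulo coboundaries. -/
abbrev KoszulCohomology (x : ι → R) (i : ℕ) : Type (max w u v) :=
  LinearMap.ker (koszulHomD M x i) ⧸
    (koszulCoboundaries M x i).submoduleOf (LinearMap.ker (koszulHomD M x i))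

/-- The least `i` such that `H^i(Hom(K_•(x), M)) ≠ 0`, with value `⊤` if there is none. -/
noncomputable def koszulGradeSeq (x : ι → R) : ℕ∞ :=
  ⨅ (i : ℕ) (_ : Nontrivial (KoszulCohomology M x i)), (i : ℕ∞)

/-- The Koszul grade of the ideal `a` on `M`: the supremum of the Koszul grades of the finitely
generated ideals contained in `a`, each computed from a finite generating sequence `x`
(all generating sequences give the same value). -/
noncomputable def koszulGrade (a : Ideal R) : ℕ∞ :=
  ⨆ (n : ℕ) (x : Fin n → R) (_ : Ideal.span (Set.range x) ≤ a), koszulGradeSeq M x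

end Koszul

section Cech

variable {R : Type u} [CommRing R] {ι : Type w} [LinearOrder ι]
variable (M : Type v) [AddCommGroup M] [Module R M]

/-- The localization of `M` at the powers of `∏_{j ∈ s} x_j`. -/
abbrev CechLocalization (x : ι → R) (s : Finset ι) : Type (max u v) :=
  LocalizedModule (Submonoid.powers (∏ j ∈ s, x j)) M

lemma isUnit_end_cechLocalization (x : ι → R) {s t : Finset ι} (h : s ⊆ t)
    (a : Submonoid.powers (∏ j ∈ s, x j)) :
    IsUnit (algebraMap R (Module.End R (CechLocalization M x t)) a) := by
  obtain ⟨_, n, rfl⟩ := a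
  obtain ⟨c, hc⟩ := Finset.prod_dvd_prod_of_subset s t x h
  have hu := IsLocalizedModule.map_units
    (LocalizedModule.mkLinearMap (Submonoid.powers (∏ j ∈ t, x j)) M)
    ⟨∏ j ∈ t, x j, Submonoid.mem_powers _⟩
  have hu' : IsUnit (algebraMap R (Module.End R (CechLocalization M x t)) (∏ j ∈ s, x j)) := by
    refine (Commute.isUnit_mul_iff (Algebra.commutes (∏ j ∈ s, x j)
      (algebraMap R (Module.End R (CechLocalization M x t)) c))).1 ?_ |>.1
    rw [← map_mul, ← hc]
    exact hu
  simpa using hu'.pow n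

/-- The canonical map from the localization of `M` at `∏_{j ∈ s} x_j` to the localization at
`∏_{j ∈ t} x_j`, for `s ⊆ t`. -/
noncomputable def cechRestrict (x : ι → R) {s t : Finset ι} (h : s ⊆ t) :
    CechLocalization M x s →ₗ[R] CechLocalization M x t :=
  LocalizedModule.lift _ (LocalizedModule.mkLinearMap (Submonoid.powers (∏ j ∈ t, x j)) M)
    (isUnit_end_cechLocalization M x h)

lemma cechRestrict_comp (x : ι → R) {r s t : Finset ι} (h : r ⊆ s) (h' : s ⊆ t) :
    cechRestrict M x h' ∘ₗ cechRestrict M x h = cechRestrict M x (h.trans h') := by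
  refine IsLocalizedModule.ext (Submonoid.powers (∏ j ∈ r, x j))
    (LocalizedModule.mkLinearMap _ M) (isUnit_end_cechLocalization M x (h.trans h')) ?_
  simp only [cechRestrict, LinearMap.comp_assoc, LocalizedModule.lift_comp]

/-- The `i`-th term of the Čech complex: the product over the subsets `s` of `ι` with `i` elements
of the localizations of `M` at `∏_{j ∈ s} x_j`. -/
abbrev CechCochain (x : ι → R) (i : ℕ) : Type (max w u v) :=
  (s : Face ι i) → CechLocalization M x s.1

/-- The Čech differential
`(d f)_t = ∑_{j ∈ t} (-1) ^ #{a ∈ t | a < j} (f_{t \ {j}} restricted to t)`. -/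
noncomputable def cechD (x : ι → R) (i : ℕ) : CechCochain M x i →ₗ[R] CechCochain M x (i + 1) :=
  LinearMap.pi fun t => ∑ j : t.1, faceSign R t.1 j.1 •
    (cechRestrict M x (Finset.erase_subset j.1 t.1) ∘ₗ LinearMap.proj (t.erase j))

lemma cechD_apply (x : ι → R) (i : ℕ) (f : CechCochain M x i) (t : Face ι (i + 1)) :
    cechD M x i f t = ∑ j : t.1, faceSign R t.1 j.1 •
      cechRestrict M x (Finset.erase_subset j.1 t.1) (f (t.erase j)) := by
  simp only [cechD, LinearMap.pi_apply, LinearMap.sum_apply, LinearMap.smul_apply]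
  rfl

lemma cechD_comp_cechD (x : ι → R) (i : ℕ) : cechD M x (i + 1) ∘ₗ cechD M x i = 0 := by
  refine LinearMap.ext fun f => funext fun t => ?_
  simp only [LinearMap.comp_apply, cechD_apply, map_sum, map_smul, Finset.smul_sum,
    LinearMap.zero_apply, Pi.zero_apply]
  refine sum_erase_eq_zero t.1 _ fun j l => ?_
  have key : ∀ (s s' : Face ι i) (h : s.1 ⊆ t.1) (h' : s'.1 ⊆ t.1), s = s' →
      cechRestrict M x h (f s) = cechRestrict M x h' (f s') := by
    rintro s _ h h' rfl
    rfl
  simp only [← LinearMap.comp_apply (cechRestrict M x _) (cechRestrict M x _)]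
  simp only [cechRestrict_comp]
  have hs : (t.erase j).erase l = (t.erase ⟨l.1, Finset.mem_of_mem_erase l.2⟩).erase
      ⟨j.1, Finset.mem_erase.2 ⟨(Finset.ne_of_mem_erase l.2).symm, j.2⟩⟩ :=
    Subtype.ext Finset.erase_right_comm
  refine (congrArg (fun z => _ • _ • z + _) (key _ _ _
    ((Finset.erase_subset _ _).trans (Finset.erase_subset _ _)) hs)).trans ?_
  rw [smul_smul, smul_smul, ← add_smul,
    faceSign_swap R t.1 j.2 (Finset.mem_of_mem_erase l.2) (Finset.ne_of_mem_erase l.2).symm,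
    zero_smul]

/-- The coboundaries of the Čech complex in degree `i`. -/
noncomputable def cechCoboundaries (x : ι → R) : (i : ℕ) → Submodule R (CechCochain M x i)
  | 0 => ⊥
  | i + 1 => LinearMap.range (cechD M x i)

/-- The Čech cohomology `H^i_x(M)`, cocycles modulo coboundaries. -/
abbrev CechCohomology (x : ι → R) (i : ℕ) : Type (max w u v) :=
  LinearMap.ker (cechD M x i) ⧸ (cechCoboundaries M x i).submoduleOf (LinearMap.ker (cechD M x i))

end Cech

section Definitions

variable (R : Type u) [CommRing R]

/-- Cohen–Macaulay in the sense of Glaz: the height of each prime `p` is the Koszul grade of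
`p R_p` on `R_p`. -/
def IsCMGlaz : Prop :=
  ∀ (p : Ideal R) [p.IsPrime],
    p.height = koszulGrade (Localization.AtPrime p)
      (p.map (algebraMap R (Localization.AtPrime p)))

/-- The weakly associated primes of `M`: the primes minimal over the annihilator of some
element of `M`. -/
def weaklyAssociatedPrimes (M : Type v) [AddCommGroup M] [Module R M] : Set (Ideal R) :=
  {p | ∃ m : M, p ∈ (Ideal.torsionOf R M m).minimalPrimes}

/-- Weak Bourbaki unmixed: if a finitely generated ideal `a` has height at least its minimal
number of generators, then the weakly associated primes of `R ⧸ a` are the minimal primes of `a`. -/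
def IsWeakBourbakiUnmixed : Prop :=
  ∀ a : Ideal R, a.FG → (Submodule.spanFinrank a : ℕ∞) ≤ a.height →
    a.minimalPrimes = weaklyAssociatedPrimes R (R ⧸ a)

variable {R}

/-- Parameter sequences: `x` is weakly proregular, generates a proper ideal, and
`H^ℓ_x(R)_p ≠ 0` for every prime `p` containing `x`. -/
structure IsParameterSequence {l : ℕ} (x : Fin l → R) : Prop where
  weaklyProregular : IsWeaklyProregular x
  ne_top : Ideal.span (Set.range x) ≠ ⊤
  nontrivial : ∀ (p : Ideal R) [p.IsPrime], Ideal.span (Set.range x) ≤ p →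
    Nontrivial (LocalizedModule p.primeCompl (CechCohomology R x l))

/-- Strong parameter sequences: each nonempty initial segment is a parameter sequence. -/
def IsStrongParameterSequence {l : ℕ} (x : Fin l → R) : Prop :=
  ∀ (i : ℕ) (h : i ≤ l), 1 ≤ i → IsParameterSequence (x ∘ Fin.castLE h)

variable (R)

/-- Cohen–Macaulay in the sense of Hamilton–Marley: each strong parameter sequence on `R` is a
regular sequence on `R`. -/
def IsCMHamiltonMarley : Prop :=
  ∀ (l : ℕ) (x : Fin l → R), IsStrongParameterSequence x →
    RingTheory.Sequence.IsRegular R (List.ofFn x)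

variable {R}

/-- Cohen–Macaulay in the sense of a class `𝒜` of ideals: height and Koszul grade agree on `𝒜`. -/
def IsCMClass (𝒜 : Set (Ideal R)) : Prop :=
  ∀ a ∈ 𝒜, a.height = koszulGrade R a

end Definitions

/-- The `d`-th Veronese subring of `k[X_0, X_1, …]`: the `k`-subalgebra generated by all monomials
of degree `d`. -/
noncomputable def veronese (k : Type u) [Field k] (d : ℕ) : Subalgebra k (MvPolynomial ℕ k) :=
  Algebra.adjoin k {f | ∃ s : ℕ →₀ ℕ, s.degree = d ∧ f = MvPolynomial.monomial s 1}

end CohenMacaulay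

/-! All four senses follow from one property, `HasLongRegularSequences`: an ideal of height at least
`n` contains a weakly regular sequence of length `n`.

Such a sequence kills Koszul cohomology below degree `n` (`koszulVanishes_of_isWeaklyRegular`), so
height is at most grade. Conversely, if a prime `p` is minimal over the annihilator of an element of
`R ⧸ (rs)` with `rs` weakly regular, no finite family in `p` has Koszul cohomology vanishing through
degree `rs.length` (`exists_not_koszulVanishes`); for `rs` of length the finite height of `p`, this
bounds the grade by the height. If `l` elements `x` generate an ideal of height at least `l`, then
`R ⧸ (x)` is the top Koszul cohomology of `x`; comparing it with `R ⧸ (rs)` for `rs` of length `l`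
in `(x)` shows that weakly associated primes of `R ⧸ (x)` have height at most `l`. This is
unmixedness. For strong parameter sequences, nonvanishing top Čech cohomology forces each initial
segment to have height at least its length, and a zero divisor modulo a segment would give a weakly
associated prime that is too high.

For the polynomial ring `A` the property is proved by induction on `n`. A nonzero `f` in the ideal
becomes, after a shear, monic up to a unit in a fresh variable `Y` with `A ≅ A[Y]`, so `A ⧸ (f)` is
finite free over a copy of `A`. Killing `f` costs at most one in height, so the contraction to that
copy has height at least `n`; a sequence found there stays weakly regular on `A ⧸ (f)` by flatness,
and `f` is put in front. The Veronese ring is integral and free over `k[X_i ^ d] ≅ A`: integrality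
keeps heights from dropping under contraction, and flatness carries the sequences back up. -/

namespace CohenMacaulay

universe u v w

open RingTheory.Sequence
open scoped Pointwise

/-! ### Vanishing of Koszul cohomology and lifting of cochains -/

section KoszulVanishing

variable {R : Type u} [CommRing R] {ι : Type w} [LinearOrder ι]
variable (M : Type v) [AddCommGroup M] [Module R M]

/-- Every cocycle of `Hom(K_•(x), M)` of degree `i` is a coboundary. -/
def KoszulVanishes (x : ι → R) (i : ℕ) : Prop :=
  ∀ f : KoszulChain R ι i →ₗ[R] M, f ∘ₗ koszulD x i = 0 → f ∈ koszulCoboundaries M x i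

lemma subsingleton_koszulCohomology_iff (x : ι → R) (i : ℕ) :
    Subsingleton (KoszulCohomology M x i) ↔ KoszulVanishes M x i := by
  rw [Submodule.Quotient.subsingleton_iff, Submodule.submoduleOf_eq_top]
  rfl

lemma le_koszulGradeSeq_iff (x : ι → R) (n : ℕ) :
    (n : ℕ∞) ≤ koszulGradeSeq M x ↔ ∀ i < n, KoszulVanishes M x i := by
  rw [koszulGradeSeq, le_iInf₂_iff]
  refine forall_congr' fun i => ?_
  rw [← subsingleton_koszulCohomology_iff, ← not_nontrivial_iff_subsingleton, Nat.cast_le,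
    ← not_le, not_imp_not]

variable {M}

lemma comp_koszulD_of_mem_koszulCoboundaries {x : ι → R} {i : ℕ}
    {f : KoszulChain R ι i →ₗ[R] M} (hf : f ∈ koszulCoboundaries M x i) :
    f ∘ₗ koszulD x i = 0 := by
  cases i with
  | zero =>
    rw [show f = 0 from hf, LinearMap.zero_comp]
  | succ i =>
    obtain ⟨g, rfl⟩ := hf
    exact LinearMap.congr_fun (koszulHomD_comp_koszulHomD M x i) g

lemma comp_mem_koszulCoboundaries {N : Type*} [AddCommGroup N] [Module R N] (φ : M →ₗ[R] N)
    {x : ι → R} {i : ℕ} {f : KoszulChain R ι i →ₗ[R] M} (hf : f ∈ koszulCoboundaries M x i) :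
    φ ∘ₗ f ∈ koszulCoboundaries N x i := by
  cases i with
  | zero =>
    rw [show f = 0 from hf, LinearMap.comp_zero]
    exact Submodule.zero_mem _
  | succ i =>
    obtain ⟨g, rfl⟩ := hf
    exact ⟨φ ∘ₗ g, rfl⟩

/-- Coboundaries lift along surjections. -/
lemma exists_mem_koszulCoboundaries_comp_eq {N : Type*} [AddCommGroup N] [Module R N]
    {φ : M →ₗ[R] N} (hφ : Function.Surjective φ) {x : ι → R} {i : ℕ}
    {f : KoszulChain R ι i →ₗ[R] N} (hf : f ∈ koszulCoboundaries N x i) :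
    ∃ b ∈ koszulCoboundaries M x i, φ ∘ₗ b = f := by
  cases i with
  | zero =>
    exact ⟨0, Submodule.zero_mem _, by rw [show f = 0 from hf, LinearMap.comp_zero]⟩
  | succ i =>
    obtain ⟨g, rfl⟩ := hf
    obtain ⟨h, rfl⟩ := Module.projective_lifting_property φ g hφ
    exact ⟨h ∘ₗ koszulD x i, ⟨h, rfl⟩, rfl⟩

/-- A homomorphism from a free module which vanishes modulo `y` is a multiple of `y`. -/
lemma exists_eq_smul_of_mkQ_comp_eq_zero {α : Type*} {y : R} {f : (α →₀ R) →ₗ[R] M}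
    (hf : (y • (⊤ : Submodule R M)).mkQ ∘ₗ f = 0) : ∃ g : (α →₀ R) →ₗ[R] M, f = y • g := by
  have h (s : α) : ∃ m : M, y • m = f (Finsupp.single s 1) := by
    have h1 : f (Finsupp.single s 1) ∈ y • (⊤ : Submodule R M) := by
      rw [← Submodule.ker_mkQ (y • (⊤ : Submodule R M))]
      exact LinearMap.congr_fun hf _
    obtain ⟨m, -, hm⟩ := h1
    exact ⟨m, hm⟩
  choose c hc using h
  refine ⟨Finsupp.linearCombination R c, Finsupp.lhom_ext' fun s => LinearMap.ext_ring ?_⟩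
  simp [hc]

lemma mkQ_comp_smul {N : Type*} [AddCommGroup N] [Module R N] (y : R) (f : N →ₗ[R] M) :
    (y • (⊤ : Submodule R M)).mkQ ∘ₗ (y • f) = 0 := by
  ext z
  exact (Submodule.Quotient.mk_eq_zero _).2 (Submodule.smul_mem_pointwise_smul _ _ _ trivial)

lemma smul_linearMap_injective {N : Type*} [AddCommGroup N] [Module R N] {y : R}
    (hy : IsSMulRegular M y) : Function.Injective fun f : N →ₗ[R] M => y • f :=
  fun _ _ h => LinearMap.ext fun z => hy (LinearMap.congr_fun h z)

end KoszulVanishing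

/-! ### Contracting homotopies of the Koszul complex -/

section Homotopy

variable {R : Type u} [CommRing R] {ι : Type w} [LinearOrder ι]

lemma faceSign_mul_self (t : Finset ι) (j : ι) : faceSign R t j * faceSign R t j = 1 := by
  rw [faceSign, ← pow_add, ← two_mul, pow_mul]
  simp

/-- The contraction `e_s ↦ ± e_{s ∪ {j}}` of the Koszul complex. -/
noncomputable def koszulContraction (R : Type u) [CommRing R] (j : ι) (i : ℕ) :
    KoszulChain R ι i →ₗ[R] KoszulChain R ι (i + 1) :=
  Finsupp.linearCombination R fun s =>
    if h : j ∈ s.1 then 0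
    else Finsupp.single ⟨insert j s.1, by rw [Finset.card_insert_of_notMem h, s.2]⟩
      (faceSign R (insert j s.1) j)

lemma koszulContraction_single_of_mem {j : ι} {i : ℕ} {s : Face ι i} (h : j ∈ s.1) (r : R) :
    koszulContraction R j i (Finsupp.single s r) = 0 := by
  simp [koszulContraction, h]

lemma koszulContraction_single_of_notMem {j : ι} {i : ℕ} {s : Face ι i} (h : j ∉ s.1) (r : R) :
    koszulContraction R j i (Finsupp.single s r) =
      Finsupp.single ⟨insert j s.1, by rw [Finset.card_insert_of_notMem h, s.2]⟩
        (r * faceSign R (insert j s.1) j) := by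
  simp [koszulContraction, h]

lemma koszulD_comp_koszulContraction_zero (x : ι → R) (j : ι) :
    koszulD x 0 ∘ₗ koszulContraction R j 0 = x j • LinearMap.id := by
  refine Finsupp.lhom_ext' fun s => LinearMap.ext_ring ?_
  obtain ⟨s, hs⟩ := s
  obtain rfl := Finset.card_eq_zero.1 hs
  simp only [LinearMap.comp_apply, Finsupp.lsingle_apply]
  rw [koszulContraction_single_of_notMem (by simp), koszulD_single,
    Finset.sum_eq_single ⟨j, Finset.mem_insert_self _ _⟩]
  · simp only [LinearMap.smul_apply, LinearMap.id_apply, Finsupp.smul_single]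
    congr 1
    · exact Subtype.ext (by simp)
    · rw [← mul_assoc, mul_assoc 1, faceSign_mul_self]
      simp
  · intro b _ hb
    exact absurd (Subtype.ext (by simpa using b.2)) hb
  · exact fun h => absurd (Finset.mem_univ _) h

/-- If `j ∈ s`, only the `j`-th face survives the contraction. If `j ∉ s`, the `j`-th face of `s ∪
{j}` gives back `s`, and the other faces cancel against the second composite by `faceSign_swap`. -/
lemma koszulD_comp_koszulContraction_succ (x : ι → R) (j : ι) (i : ℕ) :
    koszulD x (i + 1) ∘ₗ koszulContraction R j (i + 1) +
      koszulContraction R j i ∘ₗ koszulD x i = x j • LinearMap.id := by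
  refine Finsupp.lhom_ext' fun s => LinearMap.ext_ring ?_
  simp only [LinearMap.comp_apply, Finsupp.lsingle_apply, LinearMap.add_apply,
    LinearMap.smul_apply, LinearMap.id_apply, Finsupp.smul_single, smul_eq_mul, mul_one]
  by_cases hj : j ∈ s.1
  · rw [koszulContraction_single_of_mem hj, map_zero, zero_add, koszulD_single, map_sum,
      Finset.sum_eq_single ⟨j, hj⟩]
    · rw [koszulContraction_single_of_notMem (by simp)]
      have h1 : insert j (s.1.erase j) = s.1 := Finset.insert_erase hj
      congr 1
      · exact Subtype.ext h1
      · simp only [h1]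
        linear_combination x j * faceSign_mul_self (R := R) s.1 j
    · intro b _ hb
      refine koszulContraction_single_of_mem ?_ _
      exact Finset.mem_erase.2 ⟨fun h => hb (Subtype.ext h.symm), hj⟩
    · simp
  · set t : Face ι (i + 2) := ⟨insert j s.1, by rw [Finset.card_insert_of_notMem hj, s.2]⟩ with ht
    have hjt : j ∈ t.1 := Finset.mem_insert_self _ _
    have hst : t.1.erase j = s.1 := Finset.erase_insert hj
    rw [koszulContraction_single_of_notMem hj, koszulD_single, koszulD_single, map_sum,
      ← Finset.add_sum_erase _ _ (Finset.mem_univ (⟨j, hjt⟩ : t.1)), add_assoc]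
    have h0 : Finsupp.single (t.erase ⟨j, hjt⟩)
        (1 * faceSign R (insert j s.1) j * (faceSign R t.1 j * x j)) = Finsupp.single s (x j) := by
      congr 1
      · exact Subtype.ext hst
      · linear_combination x j * faceSign_mul_self (R := R) t.1 j
    rw [h0, add_eq_left]
    have h1 : ∀ l : s.1, l.1 ∈ t.1 := fun l => Finset.mem_insert_of_mem l.2
    rw [add_eq_zero_iff_eq_neg, ← Finset.sum_neg_distrib]
    symm
    refine Finset.sum_bij (fun l _ => ⟨l.1, h1 l⟩) ?_ ?_ ?_ ?_
    · intro l _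
      refine Finset.mem_erase.2 ⟨fun h => hj ?_, Finset.mem_univ _⟩
      have h' : l.1 = j := congrArg (fun z : t.1 => z.1) h
      exact h' ▸ l.2
    · intro a _ b _ h
      exact Subtype.ext (congrArg (fun z : t.1 => z.1) h)
    · rintro ⟨b, hb⟩ hb'
      have hbj : b ≠ j := fun h => (Finset.mem_erase.1 hb').1 (Subtype.ext h)
      exact ⟨⟨b, (Finset.mem_insert.1 hb).resolve_left hbj⟩, Finset.mem_univ _, rfl⟩
    · intro l _
      have hlj : l.1 ≠ j := fun h => hj (h ▸ l.2)
      have hjl : j ∉ s.1.erase l.1 := fun h => hj (Finset.mem_of_mem_erase h)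
      have h2 : insert j (s.1.erase l.1) = t.1.erase l.1 :=
        (Finset.erase_insert_of_ne hlj.symm).symm
      rw [koszulContraction_single_of_notMem hjl, ← Finsupp.single_neg]
      congr 1
      · exact Subtype.ext h2
      · have h3 := faceSign_swap R t.1 hjt (h1 l) hlj.symm
        rw [hst] at h3
        simp only [h2]
        have h4 := faceSign_mul_self (R := R) t.1 j
        have h6 := faceSign_mul_self (R := R) (t.1.erase l.1) j
        change _ = 1 * faceSign R t.1 j * (faceSign R t.1 l.1 * x l.1)
        generalize faceSign R t.1 j = a at *
        generalize faceSign R s.1 l.1 = b at *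
        generalize faceSign R t.1 l.1 = c at *
        generalize faceSign R (t.1.erase l.1) j = e at *
        have h8 : b * e = - (a * c) := by
          have h10 : a * b = - (c * e) := by linear_combination h3
          calc b * e = (a * a) * (b * e) := by rw [h4, one_mul]
            _ = a * e * (a * b) := by ring
            _ = - (a * c) * (e * e) := by rw [h10]; ring
            _ = _ := by rw [h6, mul_one]
        linear_combination (-x l.1) * h8

variable {M : Type v} [AddCommGroup M] [Module R M]

/-- The ideal generated by `x` annihilates the Koszul cohomology of `x`. -/
lemma smul_mem_koszulCoboundaries {x : ι → R} {y : R} (hy : y ∈ Ideal.span (Set.range x))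
    {i : ℕ} {f : KoszulChain R ι i →ₗ[R] M} (hf : f ∘ₗ koszulD x i = 0) :
    y • f ∈ koszulCoboundaries M x i := by
  suffices h : Ideal.span (Set.range x) ≤
      (koszulCoboundaries M x i).comap (LinearMap.toSpanSingleton R _ f) from h hy
  rw [Ideal.span_le]
  rintro _ ⟨j, rfl⟩
  change x j • f ∈ koszulCoboundaries M x i
  cases i with
  | zero =>
    change x j • f = 0
    have h := congrArg (f ∘ₗ ·) (koszulD_comp_koszulContraction_zero x j)
    simp only [← LinearMap.comp_assoc, hf, LinearMap.zero_comp, LinearMap.comp_smul,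
      LinearMap.comp_id] at h
    exact h.symm
  | succ i =>
    have h := congrArg (f ∘ₗ ·) (koszulD_comp_koszulContraction_succ x j i)
    simp only [LinearMap.comp_add, ← LinearMap.comp_assoc, hf, LinearMap.zero_comp,
      LinearMap.comp_smul, LinearMap.comp_id, zero_add] at h
    exact ⟨f ∘ₗ koszulContraction R j i, h⟩

end Homotopy

/-! ### Weakly regular sequences against Koszul cohomology -/

section RegularSequences

variable {R : Type u} [CommRing R] {ι : Type w} [LinearOrder ι]

lemma mem_ofList_cons_smul_top_iff {M : Type v} [AddCommGroup M] [Module R M] (y : R)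
    (rs : List R) (m : M) :
    m ∈ Ideal.ofList (y :: rs) • (⊤ : Submodule R M) ↔
      (y • (⊤ : Submodule R M)).mkQ m ∈ Ideal.ofList rs • (⊤ : Submodule R (QuotSMulTop y M)) := by
  have h : Ideal.ofList rs • (⊤ : Submodule R (QuotSMulTop y M)) =
      (Ideal.ofList rs • (⊤ : Submodule R M)).map (y • (⊤ : Submodule R M)).mkQ := by
    rw [Submodule.map_smul'', Submodule.map_top, Submodule.range_mkQ]
  rw [h, ← Submodule.mem_comap, Submodule.comap_map_eq, Submodule.ker_mkQ,
    Ideal.ofList_cons_smul, sup_comm]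

/-- If the ideal generated by `x` contains a weakly `M`-regular sequence of length `n`, then the
Koszul cohomology of `x` on `M` vanishes in degrees below `n`. -/
theorem koszulVanishes_of_isWeaklyRegular {x : ι → R} {rs : List R}
    (hrs : ∀ r ∈ rs, r ∈ Ideal.span (Set.range x)) {M : Type v} [AddCommGroup M] [Module R M]
    (h : IsWeaklyRegular M rs) {i : ℕ} (hi : i < rs.length) : KoszulVanishes M x i := by
  induction rs generalizing M i with
  | nil => exact absurd hi (Nat.not_lt_zero _)
  | cons y rs ih =>
    rw [isWeaklyRegular_cons_iff] at h
    intro f hf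
    have hyf := smul_mem_koszulCoboundaries (hrs y (by simp)) hf
    cases i with
    | zero =>
      have h0 : y • f = y • (0 : KoszulChain R ι 0 →ₗ[R] M) := by
        rw [smul_zero]
        exact hyf
      rw [smul_linearMap_injective h.1 h0]
      exact Submodule.zero_mem _
    | succ i =>
      -- Since `y` kills cohomology, `y • f` is the coboundary of some `g`. Modulo `y`, `g` is a
      -- cocycle of lower degree, hence by induction a coboundary, so `g = b + y • e` with `b` a
      -- coboundary; cancelling `y` shows that `f` is the coboundary of `e`.
      obtain ⟨g, hg⟩ := hyf
      have hg' : g ∘ₗ koszulD x i = y • f := hg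
      have h1 := ih (fun r hr => hrs r (List.mem_cons_of_mem _ hr)) h.2 (Nat.lt_of_succ_lt_succ hi)
        ((y • (⊤ : Submodule R M)).mkQ ∘ₗ g) (by rw [LinearMap.comp_assoc, hg', mkQ_comp_smul])
      obtain ⟨b, hb, hbg⟩ := exists_mem_koszulCoboundaries_comp_eq (Submodule.mkQ_surjective _) h1
      obtain ⟨e, he⟩ := exists_eq_smul_of_mkQ_comp_eq_zero (y := y) (f := g - b) (by
        rw [LinearMap.comp_sub, hbg, sub_self])
      refine ⟨e, smul_linearMap_injective h.1 ?_⟩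
      change y • (e ∘ₗ koszulD x i) = y • f
      rw [← LinearMap.smul_comp, ← he, LinearMap.sub_comp,
        comp_koszulD_of_mem_koszulCoboundaries hb, sub_zero, hg']

/-- Exactness of `H^i(M) → H^i(M ⧸ yM) → H^{i+1}(M)`, the outer terms being zero. -/
lemma KoszulVanishes.quotSMulTop {M : Type v} [AddCommGroup M] [Module R M] {x : ι → R} {i : ℕ}
    {y : R} (hy : IsSMulRegular M y) (h : KoszulVanishes M x i) (h' : KoszulVanishes M x (i + 1)) :
    KoszulVanishes (QuotSMulTop y M) x i := by
  intro f hf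
  obtain ⟨g, rfl⟩ := Module.projective_lifting_property
    (y • (⊤ : Submodule R M)).mkQ f (Submodule.mkQ_surjective _)
  rw [LinearMap.comp_assoc] at hf
  obtain ⟨e, he⟩ := exists_eq_smul_of_mkQ_comp_eq_zero hf
  have he' : e ∘ₗ koszulD x (i + 1) = 0 := by
    refine smul_linearMap_injective hy ?_
    simp only
    rw [← LinearMap.smul_comp, ← he, smul_zero, LinearMap.comp_assoc, koszulD_comp_koszulD,
      LinearMap.comp_zero]
  obtain ⟨c, hc⟩ := h' e he'
  have hc' : c ∘ₗ koszulD x i = e := hc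
  have h1 := h (g - y • c) (by rw [LinearMap.sub_comp, LinearMap.smul_comp, hc', he, sub_self])
  have h2 := comp_mem_koszulCoboundaries (y • (⊤ : Submodule R M)).mkQ h1
  rwa [LinearMap.comp_sub, mkQ_comp_smul, sub_zero] at h2

lemma koszulVanishes_zero_iff {M : Type v} [AddCommGroup M] [Module R M] (x : ι → R) :
    KoszulVanishes M x 0 ↔ ∀ m : M, (∀ j, x j • m = 0) → m = 0 := by
  have key (f : KoszulChain R ι 0 →ₗ[R] M) (m : M)
      (hfm : f (Finsupp.single ⟨∅, rfl⟩ 1) = m) (j : ι) :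
      f (koszulD x 0 (Finsupp.single ⟨{j}, Finset.card_singleton j⟩ 1)) = x j • m := by
    rw [koszulD_single, Finset.sum_eq_single ⟨j, Finset.mem_singleton_self j⟩]
    · rw [← hfm, ← map_smul, Finsupp.smul_single]
      congr 2
      · exact Subtype.ext (by simp)
      · simp [faceSign, Finset.filter_singleton]
    · intro b _ hb
      exact absurd (Subtype.ext (Finset.mem_singleton.1 b.2)) hb
    · exact fun h => absurd (Finset.mem_univ _) h
  constructor
  · intro h m hm
    have h1 : Finsupp.linearCombination R (fun _ : Face ι 0 => m) = 0 := by
      refine h _ (Finsupp.lhom_ext' fun t => LinearMap.ext_ring ?_)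
      obtain ⟨t, ht⟩ := t
      obtain ⟨j, rfl⟩ := Finset.card_eq_one.1 ht
      simp only [LinearMap.comp_apply, Finsupp.lsingle_apply, LinearMap.zero_apply]
      rw [key _ m (by simp), hm]
    have h2 := LinearMap.congr_fun h1 (Finsupp.single ⟨∅, rfl⟩ 1)
    simpa using h2
  · intro h f hf
    have h1 := h (f (Finsupp.single ⟨∅, rfl⟩ 1)) fun j => by
      rw [← key f _ rfl]
      exact LinearMap.congr_fun hf _
    refine Finsupp.lhom_ext' fun t => LinearMap.ext_ring ?_
    obtain ⟨t, ht⟩ := t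
    obtain rfl := Finset.card_eq_zero.1 ht
    exact h1

/-- If the Koszul cohomology of `z` on `M` vanishes up to the length of the weakly regular sequence
`rs`, then no nonzero element of `M ⧸ (rs) M` is annihilated by `z`. -/
theorem mem_ofList_smul_top_of_koszulVanishes {z : ι → R} {rs : List R} {M : Type v}
    [AddCommGroup M] [Module R M] (h : IsWeaklyRegular M rs)
    (hz : ∀ i ≤ rs.length, KoszulVanishes M z i) {m : M}
    (hm : ∀ j, z j • m ∈ Ideal.ofList rs • (⊤ : Submodule R M)) :
    m ∈ Ideal.ofList rs • (⊤ : Submodule R M) := by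
  induction rs generalizing M with
  | nil =>
    simp only [Ideal.ofList_nil, Submodule.bot_smul, Submodule.mem_bot] at hm ⊢
    exact (koszulVanishes_zero_iff z).1 (hz 0 le_rfl) m hm
  | cons y rs ih =>
    rw [isWeaklyRegular_cons_iff] at h
    rw [mem_ofList_cons_smul_top_iff]
    refine ih h.2 (fun i hi => ?_) fun j => ?_
    · exact (hz i (Nat.le_succ_of_le hi)).quotSMulTop h.1 (hz (i + 1) (Nat.succ_le_succ hi))
    · rw [← map_smul, ← mem_ofList_cons_smul_top_iff]
      exact hm j

/-- A Koszul cohomology class whose degree is the length of a weakly regular sequence `rs` in the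
ideal generated by `x` has the same annihilator as some element of `M ⧸ (rs) M`. -/
theorem exists_smul_mem_koszulCoboundaries_iff {x : ι → R} {rs : List R}
    (hrs : ∀ r ∈ rs, r ∈ Ideal.span (Set.range x)) {M : Type v} [AddCommGroup M] [Module R M]
    (h : IsWeaklyRegular M rs) {f : KoszulChain R ι rs.length →ₗ[R] M}
    (hf : f ∘ₗ koszulD x rs.length = 0) :
    ∃ m : M, ∀ r : R, r • f ∈ koszulCoboundaries M x rs.length ↔
      r • m ∈ Ideal.ofList rs • (⊤ : Submodule R M) := by
  induction rs generalizing M with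
  | nil =>
    refine ⟨f (Finsupp.single ⟨∅, rfl⟩ 1), fun r => ?_⟩
    simp only [Ideal.ofList_nil, Submodule.bot_smul, Submodule.mem_bot]
    constructor
    · intro hr
      exact LinearMap.congr_fun (show r • f = 0 from hr) _
    · intro hr
      refine Finsupp.lhom_ext' fun t => LinearMap.ext_ring ?_
      obtain ⟨t, ht⟩ := t
      obtain rfl := Finset.card_eq_zero.1 ht
      exact hr
  | cons y rs ih =>
    have hv := koszulVanishes_of_isWeaklyRegular hrs h (i := rs.length) (Nat.lt_succ_self _)
    rw [isWeaklyRegular_cons_iff] at h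
    -- The class of `g` modulo `y` is a preimage of the class of `f` under the connecting map from
    -- the cohomology of `M ⧸ yM`. That map is injective by `hv`, so the two classes have the same
    -- annihilator.
    obtain ⟨g, hg⟩ := smul_mem_koszulCoboundaries (hrs y (by simp)) hf
    have hg' : g ∘ₗ koszulD x rs.length = y • f := hg
    obtain ⟨m, hm⟩ := ih (fun r hr => hrs r (List.mem_cons_of_mem _ hr)) h.2
      (f := (y • (⊤ : Submodule R M)).mkQ ∘ₗ g) (by rw [LinearMap.comp_assoc, hg', mkQ_comp_smul])
    obtain ⟨m, rfl⟩ := Submodule.mkQ_surjective _ m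
    refine ⟨m, fun r => ?_⟩
    rw [mem_ofList_cons_smul_top_iff, map_smul, ← hm, ← LinearMap.comp_smul]
    constructor
    · rintro ⟨e, he⟩
      have he' : e ∘ₗ koszulD x rs.length = r • f := he
      have h1 := hv (r • g - y • e) (by
        rw [LinearMap.sub_comp, LinearMap.smul_comp, LinearMap.smul_comp, hg', he', smul_comm,
          sub_self])
      have h2 := comp_mem_koszulCoboundaries (y • (⊤ : Submodule R M)).mkQ h1
      rwa [LinearMap.comp_sub, mkQ_comp_smul, sub_zero] at h2
    · intro hr
      obtain ⟨b, hb, hbg⟩ := exists_mem_koszulCoboundaries_comp_eq (Submodule.mkQ_surjective _) hr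
      obtain ⟨e, he⟩ := exists_eq_smul_of_mkQ_comp_eq_zero (y := y) (f := r • g - b) (by
        rw [LinearMap.comp_sub, hbg, sub_self])
      refine ⟨e, smul_linearMap_injective h.1 ?_⟩
      change y • (e ∘ₗ koszulD x rs.length) = y • r • f
      rw [← LinearMap.smul_comp, ← he, LinearMap.sub_comp,
        comp_koszulD_of_mem_koszulCoboundaries hb, sub_zero, LinearMap.smul_comp, hg', smul_comm]

/-- In the top degree, the Koszul cohomology of `x` on `R` is `R ⧸ (x)`. -/
lemma linearCombination_mem_koszulCoboundaries_iff {l : ℕ} (x : Fin l → R) (m : R) :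
    Finsupp.linearCombination R (fun _ : Face (Fin l) l => m) ∈ koszulCoboundaries R x l ↔
      m ∈ Ideal.span (Set.range x) := by
  -- An `l`-element set has no subset of size `l + 1`, so every cochain of degree `l` is a cocycle.
  have hempty : IsEmpty (Face (Fin l) (l + 1)) :=
    ⟨fun s => by simpa [s.2] using Finset.card_le_univ s.1⟩
  constructor
  · intro h
    cases l with
    | zero =>
      have h1 := LinearMap.congr_fun (show Finsupp.linearCombination R
        (fun _ : Face (Fin 0) 0 => m) = 0 from h) (Finsupp.single ⟨∅, rfl⟩ 1)
      have h2 : m = 0 := by simpa using h1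
      rw [h2]
      exact Submodule.zero_mem _
    | succ l =>
      obtain ⟨g, hg⟩ := h
      have h1 := LinearMap.congr_fun hg
        (Finsupp.single ⟨Finset.univ, by simp⟩ 1)
      rw [Finsupp.linearCombination_single, one_smul] at h1
      rw [← h1]
      change g (koszulD x l _) ∈ _
      rw [koszulD_single, map_sum]
      refine Submodule.sum_mem _ fun j _ => ?_
      rw [show ∀ (s : Face (Fin (l + 1)) l) (a b : R),
        Finsupp.single s (1 * (a * b)) = b • Finsupp.single s a from fun s a b => by
          rw [Finsupp.smul_single, smul_eq_mul, one_mul, mul_comm], map_smul, smul_eq_mul]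
      exact Ideal.mul_mem_right _ _ (Ideal.subset_span ⟨_, rfl⟩)
  · intro h
    have h1 := smul_mem_koszulCoboundaries h (i := l)
      (f := Finsupp.linearCombination R (fun _ : Face (Fin l) l => (1 : R)))
      (Finsupp.lhom_ext' fun t => hempty.elim t)
    convert! h1 using 1
    refine Finsupp.lhom_ext' fun t => LinearMap.ext_ring ?_
    simp

/-- If `rs` is a weakly regular sequence of length `l` in the ideal generated by `l` elements `x`,
then each element of `R ⧸ (x)` has the same annihilator as some element of `R ⧸ (rs)`. -/
theorem exists_mul_mem_ofList_iff {l : ℕ} {x : Fin l → R} {rs : List R} (hl : rs.length = l)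
    (hrs : ∀ r ∈ rs, r ∈ Ideal.span (Set.range x)) (h : IsWeaklyRegular R rs) (m : R) :
    ∃ v : R, ∀ r : R, r * m ∈ Ideal.span (Set.range x) ↔ r * v ∈ Ideal.ofList rs := by
  subst hl
  have hempty : IsEmpty (Face (Fin rs.length) (rs.length + 1)) :=
    ⟨fun s => by simpa [s.2] using Finset.card_le_univ s.1⟩
  obtain ⟨v, hv⟩ := exists_smul_mem_koszulCoboundaries_iff hrs h
    (f := Finsupp.linearCombination R (fun _ : Face (Fin rs.length) rs.length => m))
    (Finsupp.lhom_ext' fun t => hempty.elim t)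
  refine ⟨v, fun r => ?_⟩
  rw [← linearCombination_mem_koszulCoboundaries_iff]
  have h1 := hv r
  rw [smul_eq_mul, smul_eq_mul, Ideal.mul_top] at h1
  rw [← h1]
  refine iff_of_eq (congrArg (· ∈ _) ?_)
  refine Finsupp.lhom_ext' fun t => LinearMap.ext_ring ?_
  simp

/-- The length of a weakly regular sequence in a prime is at most the height of the prime. -/
theorem length_le_height_of_isWeaklyRegular {rs : List R} (h : IsWeaklyRegular R rs)
    (p : Ideal R) [p.IsPrime] (hp : ∀ r ∈ rs, r ∈ p) : (rs.length : ℕ∞) ≤ p.height := by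
  induction rs using List.reverseRecOn generalizing p with
  | nil => simp
  | append_singleton rs r ih =>
    rw [isWeaklyRegular_append_iff, isWeaklyRegular_singleton_iff] at h
    have hle : Ideal.ofList rs ≤ p := Ideal.span_le.2 fun s hs => hp s (by simp [hs.out])
    obtain ⟨q, hq, hqp⟩ := Ideal.exists_minimalPrimes_le hle
    have := hq.1.1
    -- Elements of a minimal prime of an ideal are zero divisors modulo that ideal, whereas `r` is
    -- regular modulo `(rs)`.
    have hrq : r ∉ q := by
      intro hr
      obtain ⟨y, hy, hry⟩ := Ideal.exists_mul_mem_of_mem_minimalPrimes hq hr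
      have h2 := h.2
      rw [isSMulRegular_quotient_iff_mem_of_smul_mem] at h2
      simp only [smul_eq_mul, Ideal.mul_top] at h2
      exact hy (h2 y hry)
    have hlt : q < p := lt_of_le_of_ne hqp fun h => hrq (h ▸ hp r (by simp))
    refine le_trans ?_ (Ideal.height_add_one_le_of_lt_of_isPrime hlt)
    have := ih h.1 q fun s hs => hq.1.2 (Ideal.subset_span hs)
    rw [List.length_append, List.length_singleton, Nat.cast_add, Nat.cast_one]
    gcongr

/-- For each `x j` in turn, multiply by its largest power that stays outside `N`; the elements
treated before still send the result into `N`. -/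
lemma exists_smul_notMem_of_pow_smul_mem {M : Type v} [AddCommGroup M] [Module R M]
    {N : Submodule R M} {m : M} (hm : m ∉ N) (s : Finset ι) (x : ι → R)
    (hx : ∀ j ∈ s, ∃ n : ℕ, x j ^ n • m ∈ N) :
    ∃ c : R, c • m ∉ N ∧ ∀ j ∈ s, x j • c • m ∈ N := by
  induction s using Finset.induction_on with
  | empty => exact ⟨1, by simpa using hm, by simp⟩
  | insert a s ha ih =>
    obtain ⟨c, hc, hcs⟩ := ih fun j hj => hx j (Finset.mem_insert_of_mem hj)
    have hex : ∃ n : ℕ, x a ^ n • c • m ∈ N := by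
      obtain ⟨n, hn⟩ := hx a (Finset.mem_insert_self _ _)
      exact ⟨n, by rw [smul_comm]; exact N.smul_mem _ hn⟩
    classical
    obtain ⟨n, hn⟩ : ∃ n, Nat.find hex = n + 1 := by
      refine Nat.exists_eq_succ_of_ne_zero fun h0 => hc ?_
      have := Nat.find_spec hex
      rwa [h0, pow_zero, one_smul] at this
    have h1 := Nat.find_spec hex
    have h2 := Nat.find_min hex (m := n) (by omega)
    rw [hn] at h1
    refine ⟨x a ^ n * c, by rwa [mul_smul], fun j hj => ?_⟩
    rcases Finset.mem_insert.1 hj with rfl | hj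
    · rwa [mul_smul, smul_smul, ← pow_succ']
    · rw [mul_smul, smul_comm]
      exact N.smul_mem _ (hcs j hj)

/-- Locally at `p` the radical of `I` is `p`: otherwise some prime between `I` and `p` would avoid
`x`, against minimality. -/
lemma exists_notMem_mul_pow_mem_of_mem_minimalPrimes {I p : Ideal R} (hp : p ∈ I.minimalPrimes)
    {x : R} (hx : x ∈ p) : ∃ s ∉ p, ∃ n : ℕ, s * x ^ n ∈ I := by
  have := hp.1.1
  by_contra! hcon
  let S : Submonoid R := p.primeCompl ⊔ Submonoid.powers x
  have hS : Disjoint (I : Set R) (S : Set R) := by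
    rw [Set.disjoint_left]
    intro y hyI hyS
    obtain ⟨s, hs, _, ⟨n, rfl⟩, rfl⟩ := Submonoid.mem_sup.1 hyS
    exact hcon s hs n hyI
  obtain ⟨q, hq, hIq, hqS⟩ := Ideal.exists_le_prime_disjoint I S hS
  have hqp : q ≤ p := fun y hy => by
    by_contra hyp
    exact Set.disjoint_left.1 hqS hy (Submonoid.mem_sup_left (S := p.primeCompl) hyp)
  have hxq : x ∈ q := hp.2 ⟨hq, hIq⟩ hqp hx
  exact Set.disjoint_left.1 hqS hxq (Submonoid.mem_sup_right (Submonoid.mem_powers x))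

/-- If a prime `p` is minimal over the annihilator of an element of `R ⧸ (rs)`, where `rs` is
weakly regular, then the Koszul cohomology of each finite family in `p` is nonzero in some degree
at most the length of `rs`. -/
theorem exists_not_koszulVanishes {rs : List R} (h : IsWeaklyRegular R rs) {v : R} {p I : Ideal R}
    (hI : ∀ r, r ∈ I ↔ r * v ∈ Ideal.ofList rs) (hp : p ∈ I.minimalPrimes) [Finite ι] {z : ι → R}
    (hz : ∀ j, z j ∈ p) : ∃ i ≤ rs.length, ¬ KoszulVanishes R z i := by
  by_contra! hcon
  have := Fintype.ofFinite ι
  have := hp.1.1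
  choose s hs n hsn using fun j => exists_notMem_mul_pow_mem_of_mem_minimalPrimes hp (hz j)
  -- Multiplying `v` by all the `s j` makes a power of every `z j` kill it modulo `(rs)`, and it
  -- remains nonzero there because the product is outside `p ⊇ I`. A further multiple is then
  -- nonzero and killed by all `z j`.
  have hprod : ∏ j, s j ∉ p := fun h => by
    obtain ⟨j, _, hj⟩ := (Ideal.IsPrime.prod_mem_iff).1 h
    exact hs j hj
  have hm : (∏ j, s j) * v ∉ Ideal.ofList rs := fun h => hprod (hp.1.2 ((hI _).2 h))
  obtain ⟨c, hc, hcz⟩ := exists_smul_notMem_of_pow_smul_mem (R := R) (M := R) hm Finset.univ z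
    fun j _ => ⟨n j, by
      rw [smul_eq_mul, ← mul_assoc, ← hI, mul_comm, ← Finset.mul_prod_erase _ _ (Finset.mem_univ j),
        mul_right_comm]
      exact Ideal.mul_mem_right _ _ (hsn j)⟩
  refine hc ?_
  have h1 := mem_ofList_smul_top_of_koszulVanishes h hcon (m := c • ((∏ j, s j) * v))
  simp only [smul_eq_mul, Ideal.mul_top] at h1 hcz ⊢
  exact h1 fun j => hcz j (Finset.mem_univ j)

end RegularSequences

/-- Each ideal of height at least `n` contains a weakly regular sequence of length `n`. -/
def HasLongRegularSequences (R : Type u) [CommRing R] : Prop :=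
  ∀ (a : Ideal R) (n : ℕ), (n : ℕ∞) ≤ a.height →
    ∃ rs : List R, rs.length = n ∧ (∀ r ∈ rs, r ∈ a) ∧ IsWeaklyRegular R rs

/-! ### Height, Koszul grade and unmixedness -/

section Grade

variable {R : Type u} [CommRing R]

lemma length_le_koszulGrade {a : Ideal R} {rs : List R} (hrs : ∀ r ∈ rs, r ∈ a)
    (h : IsWeaklyRegular R rs) : (rs.length : ℕ∞) ≤ koszulGrade R a := by
  have h1 : Ideal.span (Set.range rs.get) ≤ a := by
    rw [Ideal.span_le]
    rintro _ ⟨j, rfl⟩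
    exact hrs _ (List.get_mem _ _)
  refine le_trans ?_ (le_iSup_of_le rs.length (le_iSup₂_of_le rs.get h1 le_rfl))
  rw [le_koszulGradeSeq_iff]
  refine fun i hi => koszulVanishes_of_isWeaklyRegular (fun r hr => ?_) h hi
  obtain ⟨j, rfl⟩ := List.mem_iff_get.1 hr
  exact Ideal.subset_span ⟨j, rfl⟩

lemma length_le_height_ofList {rs : List R} (h : IsWeaklyRegular R rs) :
    (rs.length : ℕ∞) ≤ (Ideal.ofList rs).height := by
  rw [Ideal.height_eq_inf_minimalPrimes]
  refine le_iInf₂ fun p hp => ?_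
  have := hp.1.1
  exact length_le_height_of_isWeaklyRegular h p fun r hr => hp.1.2 (Ideal.subset_span hr)

/-- As `(rs)` already has height at least that of `p`, the prime `p` is minimal over `(rs)`, the
annihilator of `1` in `R ⧸ (rs)`. So each finite family in `a` has nonzero cohomology by degree
`rs.length`. -/
lemma koszulGrade_le_length {a p : Ideal R} [p.IsPrime] (hap : a ≤ p) {rs : List R}
    (hrs : ∀ r ∈ rs, r ∈ p) (h : IsWeaklyRegular R rs) (hp : p.height = rs.length) :
    koszulGrade R a ≤ rs.length := by
  have : p.FiniteHeight := Ideal.finiteHeight_iff_lt.2 (Or.inr (hp ▸ ENat.natCast_lt_top _))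
  have hmin : p ∈ (Ideal.ofList rs).minimalPrimes :=
    Ideal.mem_minimalPrimes_of_height_le (Ideal.span_le.2 hrs)
      (hp.trans_le (length_le_height_ofList h))
  refine iSup_le fun n => iSup₂_le fun x hx => ?_
  obtain ⟨i, hi, hni⟩ := exists_not_koszulVanishes h (v := 1) (fun r => by rw [mul_one]) hmin
    (z := x) fun j => hap (hx (Ideal.subset_span ⟨j, rfl⟩))
  by_contra! hcon
  have h1 : ((rs.length + 1 : ℕ) : ℕ∞) ≤ koszulGradeSeq R x := by
    rw [Nat.cast_add, Nat.cast_one]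
    exact Order.add_one_le_of_lt hcon
  exact hni ((le_koszulGradeSeq_iff R x _).1 h1 i (Nat.lt_succ_of_le hi))

theorem HasLongRegularSequences.height_eq_koszulGrade (hR : HasLongRegularSequences R)
    (a : Ideal R) : a.height = koszulGrade R a := by
  refine le_antisymm ?_ ?_
  · refine ENat.forall_natCast_le_iff_le.1 fun n hn => ?_
    obtain ⟨rs, rfl, hrs, h⟩ := hR a n hn
    exact length_le_koszulGrade hrs h
  · rw [Ideal.height_eq_inf_minimalPrimes]
    refine le_iInf₂ fun p hp => ?_
    have := hp.1.1
    cases hn : p.height with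
    | top => exact le_top
    | coe n =>
      obtain ⟨rs, rfl, hrs, h⟩ := hR p n hn.ge
      exact koszulGrade_le_length hp.1.2 hrs h hn

theorem HasLongRegularSequences.isCMClass (hR : HasLongRegularSequences R)
    (𝒜 : Set (Ideal R)) : IsCMClass 𝒜 :=
  fun a _ => hR.height_eq_koszulGrade a

/-- Weakly regular sequences chosen in `p` survive localization, and the height of `p` is unchanged,
so both grade bounds can be applied in `R_p`. -/
theorem HasLongRegularSequences.isCMGlaz (hR : HasLongRegularSequences R) : IsCMGlaz R := by
  intro p _
  have hmap (rs : List R) (hrs : ∀ r ∈ rs, r ∈ p) :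
      ∀ r ∈ rs.map (algebraMap R (Localization.AtPrime p)),
        r ∈ p.map (algebraMap R (Localization.AtPrime p)) := by
    intro r hr
    obtain ⟨s, hs, rfl⟩ := List.mem_map.1 hr
    exact Ideal.mem_map_of_mem _ (hrs s hs)
  refine le_antisymm ?_ ?_
  · refine ENat.forall_natCast_le_iff_le.1 fun n hn => ?_
    obtain ⟨rs, rfl, hrs, h⟩ := hR p n hn
    have h1 := length_le_koszulGrade (hmap rs hrs) (h.of_isLocalization _ p.primeCompl)
    rwa [List.length_map] at h1
  · cases hn : p.height with
    | top => exact le_top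
    | coe n =>
      obtain ⟨rs, rfl, hrs, h⟩ := hR p n hn.ge
      have hmax := Localization.AtPrime.map_eq_maximalIdeal (I := p)
      have : (p.map (algebraMap R (Localization.AtPrime p))).IsPrime := by
        rw [hmax]
        infer_instance
      have h1 := koszulGrade_le_length le_rfl (hmap rs hrs) (h.of_isLocalization _ p.primeCompl) (by
        rw [List.length_map, ← hn, IsLocalization.height_map_of_disjoint p.primeCompl p]
        exact Set.disjoint_left.2 fun _ h h' => h h')
      rwa [List.length_map] at h1

/-- A weakly associated prime of `R ⧸ (x_1, …, x_l)`, where `(x_1, …, x_l)` has height at least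
`l`, has height at most `l`. -/
theorem HasLongRegularSequences.height_le_of_mem_minimalPrimes (hR : HasLongRegularSequences R)
    {l : ℕ} {x : Fin l → R} (hx : (l : ℕ∞) ≤ (Ideal.span (Set.range x)).height) {m : R}
    {p I : Ideal R} (hI : ∀ r, r ∈ I ↔ r * m ∈ Ideal.span (Set.range x))
    (hp : p ∈ I.minimalPrimes) : p.height ≤ l := by
  obtain ⟨rs, hl, hrs, h⟩ := hR _ l hx
  obtain ⟨v, hv⟩ := exists_mul_mem_ofList_iff hl hrs h m
  by_contra! hcon
  have h1 : ((l + 1 : ℕ) : ℕ∞) ≤ p.height := by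
    rw [Nat.cast_add, Nat.cast_one]
    exact Order.add_one_le_of_lt hcon
  -- A weakly regular sequence of length `l + 1` in `p` has vanishing Koszul cohomology through
  -- degree `l = rs.length`, which the minimality of `p` over the annihilator of `v` modulo `(rs)`
  -- forbids.
  obtain ⟨ys, hys, hysp, hyreg⟩ := hR p _ h1
  obtain ⟨i, hi, hni⟩ := exists_not_koszulVanishes h (fun r => (hI r).trans (hv r)) hp
    (z := ys.get) fun j => hysp _ (List.get_mem _ _)
  refine hni (koszulVanishes_of_isWeaklyRegular (fun r hr => ?_) hyreg (by omega))
  obtain ⟨j, rfl⟩ := List.mem_iff_get.1 hr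
  exact Ideal.subset_span ⟨j, rfl⟩

/-- Minimal primes of `a` are minimal over the annihilator of `1`. A weakly associated prime
contains `a` and has height at most the number of generators, hence at most the height of `a`, so it
is minimal. -/
theorem HasLongRegularSequences.isWeakBourbakiUnmixed (hR : HasLongRegularSequences R) :
    IsWeakBourbakiUnmixed R := by
  intro a ha hht
  refine Set.Subset.antisymm (fun p hp => ⟨1, ?_⟩) ?_
  · convert! hp using 1
    congr 1
    ext r
    change r • (1 : R ⧸ a) = 0 ↔ r ∈ a
    rw [Algebra.smul_def, mul_one, Ideal.Quotient.algebraMap_eq, Ideal.Quotient.eq_zero_iff_mem]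
  · rintro p ⟨m, hp⟩
    have := hp.1.1
    obtain ⟨m, rfl⟩ := Ideal.Quotient.mk_surjective m
    have hI (r : R) : r ∈ Ideal.torsionOf R (R ⧸ a) (Ideal.Quotient.mk a m) ↔ r * m ∈ a := by
      rw [Ideal.mem_torsionOf_iff, Algebra.smul_def, Ideal.Quotient.algebraMap_eq, ← map_mul,
        Ideal.Quotient.eq_zero_iff_mem]
    obtain ⟨x, hx⟩ : ∃ x : Fin (Submodule.spanFinrank a) → R, Ideal.span (Set.range x) = a := by
      obtain ⟨s, hs, hspan⟩ := Submodule.FG.exists_span_finset_card_eq_spanFinrank ha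
      refine ⟨fun j => (s.equivFin.symm (Fin.cast hs.symm j)).1, ?_⟩
      refine Eq.trans (congrArg Ideal.span ?_) hspan
      ext r
      constructor
      · rintro ⟨j, rfl⟩
        exact Subtype.prop _
      · exact fun hr => ⟨Fin.cast hs (s.equivFin ⟨r, hr⟩), by simp⟩
    have h1 : p.height ≤ (Submodule.spanFinrank a : ℕ∞) :=
      hR.height_le_of_mem_minimalPrimes (x := x) (by rwa [hx]) (m := m) (by rwa [hx]) hp
    have : p.FiniteHeight :=
      Ideal.finiteHeight_iff_lt.2 (Or.inr (h1.trans_lt (ENat.natCast_lt_top _)))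
    exact Ideal.mem_minimalPrimes_of_height_le
      (fun r hr => hp.1.2 ((hI r).2 (Ideal.mul_mem_right _ _ hr))) (h1.trans hht)

end Grade

/-! ### Čech cohomology and strong parameter sequences -/

section Parameters

variable {R : Type u} [CommRing R]

/-- One more factor `∏ x j` raises the exponent in each generator `x j ^ (n + 1)` by one. -/
lemma mul_prod_pow_mem_mono {ι : Type*} [Fintype ι] (x : ι → R) {t : R} {k k' : ℕ} (hk : k ≤ k')
    (h : t * (∏ j, x j) ^ k ∈ Ideal.span (Set.range fun j => x j ^ (k + 1))) :
    t * (∏ j, x j) ^ k' ∈ Ideal.span (Set.range fun j => x j ^ (k' + 1)) := by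
  induction k', hk using Nat.le_induction with
  | base => exact h
  | succ n _ ih =>
    rw [pow_succ, ← mul_assoc, mul_comm]
    suffices h : Ideal.span (Set.range fun j => x j ^ (n + 1)) ≤
        Submodule.comap (LinearMap.mulLeft R (∏ j, x j))
          (Ideal.span (Set.range fun j => x j ^ (n + 1 + 1))) from h ih
    rw [Ideal.span_le]
    rintro _ ⟨j, rfl⟩
    change (∏ j, x j) * x j ^ (n + 1) ∈ Ideal.span _
    classical
    rw [← Finset.prod_erase_mul _ _ (Finset.mem_univ j), mul_assoc, ← pow_succ']
    exact Ideal.mul_mem_left _ _ (Ideal.subset_span ⟨j, rfl⟩)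

/-- If `p` is a prime of height less than `l`, then for `l` elements `x_1, …, x_l` some power
`(x_1 ⋯ x_l) ^ k` lies in `(x_1 ^ (k + 1), …, x_l ^ (k + 1))` locally at `p`. -/
theorem exists_mul_prod_pow_mem_of_height_lt {l : ℕ} (x : Fin l → R) (p : Ideal R) [p.IsPrime]
    (hp : p.height < l) : ∃ s ∉ p, ∃ k : ℕ,
      s * (∏ j, x j) ^ k ∈ Ideal.span (Set.range fun j => x j ^ (k + 1)) := by
  induction l generalizing p with
  | zero => simp at hp
  | succ l ih =>
    by_cases h0 : x 0 ∈ p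
    swap
    · refine ⟨x 0, h0, 0, ?_⟩
      rw [pow_zero, mul_one]
      exact Ideal.subset_span ⟨0, by simp⟩
    -- `I` collects the multipliers that work for the last `l` elements. By induction no prime of
    -- height below `l` contains it; a prime over `I` inside `p` and avoiding `x 0` would be
    -- strictly below `p`, hence such a prime.
    let I : Ideal R :=
      { carrier := {t | ∃ k : ℕ, t * (∏ j : Fin l, x j.succ) ^ k ∈
          Ideal.span (Set.range fun j : Fin l => x j.succ ^ (k + 1))}
        zero_mem' := ⟨0, by simp⟩
        add_mem' := by
          rintro a b ⟨k, hk⟩ ⟨k', hk'⟩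
          refine ⟨max k k', ?_⟩
          rw [add_mul]
          exact Ideal.add_mem _ (mul_prod_pow_mem_mono (fun j : Fin l => x j.succ)
            (le_max_left _ _) hk) (mul_prod_pow_mem_mono (fun j : Fin l => x j.succ)
              (le_max_right _ _) hk')
        smul_mem' := by
          rintro c a ⟨k, hk⟩
          refine ⟨k, ?_⟩
          rw [smul_eq_mul, mul_assoc]
          exact Ideal.mul_mem_left _ _ hk }
    obtain ⟨s, hs, n, hsn⟩ : ∃ s ∉ p, ∃ n : ℕ, s * x 0 ^ n ∈ I := by
      by_contra! hcon
      let S : Submonoid R := p.primeCompl ⊔ Submonoid.powers (x 0)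
      have hS : Disjoint (I : Set R) (S : Set R) := by
        rw [Set.disjoint_left]
        intro y hyI hyS
        obtain ⟨s, hs, _, ⟨n, rfl⟩, rfl⟩ := Submonoid.mem_sup.1 hyS
        exact hcon s hs n hyI
      obtain ⟨q, hq, hIq, hqS⟩ := Ideal.exists_le_prime_disjoint I S hS
      have hxq : x 0 ∉ q := fun h =>
        Set.disjoint_left.1 hqS h (Submonoid.mem_sup_right (Submonoid.mem_powers _))
      have hqp : q < p := by
        refine lt_of_le_of_ne (fun y hy => ?_) fun h => hxq (h ▸ h0)
        by_contra hyp
        exact Set.disjoint_left.1 hqS hy (Submonoid.mem_sup_left (S := p.primeCompl) hyp)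
      have hql : q.height < l := by
        have h1 := (Ideal.height_add_one_le_of_lt_of_isPrime hqp).trans_lt hp
        rw [Nat.cast_add, Nat.cast_one] at h1
        exact lt_of_add_lt_add_right h1
      obtain ⟨s, hs, hsI⟩ := ih (fun j => x j.succ) q hql
      exact hs (hIq hsI)
    obtain ⟨k, hk⟩ := hsn
    refine ⟨s, hs, max n k, ?_⟩
    have h1 := mul_prod_pow_mem_mono (fun j : Fin l => x j.succ) (le_max_right n k) hk
    have h2 : Ideal.span (Set.range fun j : Fin l => x j.succ ^ (max n k + 1)) ≤
        Ideal.span (Set.range fun j => x j ^ (max n k + 1)) :=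
      Ideal.span_mono (by rintro _ ⟨j, rfl⟩; exact ⟨j.succ, rfl⟩)
    rw [Fin.prod_univ_succ, mul_pow, ← Nat.sub_add_cancel (le_max_left n k), pow_add]
    rw [Nat.sub_add_cancel (le_max_left n k)]
    have h3 := Ideal.mul_mem_left _ (x 0 ^ (max n k - n)) (h2 h1)
    convert! h3 using 1
    ring

lemma smul_cechRestrict_mk {ι : Type*} [LinearOrder ι] (x : ι → R) {s t : Finset ι} (h : s ⊆ t)
    (a : R) (b : Submonoid.powers (∏ j ∈ s, x j)) :
    b.1 • cechRestrict R x h (LocalizedModule.mk a b) = LocalizedModule.mk a 1 := by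
  rw [← map_smul, LocalizedModule.smul'_mk]
  change cechRestrict R x h (LocalizedModule.mk (b • a) b) = _
  rw [LocalizedModule.mk_cancel]
  exact LinearMap.congr_fun (LocalizedModule.lift_comp _ _ (isUnit_end_cechLocalization R x h)) a

/-- The top Čech cohomology of `l` elements vanishes at primes of height less than `l`. -/
theorem le_height_of_nontrivial_localizedModule_cechCohomology {l : ℕ} (x : Fin l → R)
    (p : Ideal R) [p.IsPrime]
    (h : Nontrivial (LocalizedModule p.primeCompl (CechCohomology R x l))) :
    (l : ℕ∞) ≤ p.height := by
  by_contra! hp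
  obtain ⟨l, rfl⟩ : ∃ l', l = l' + 1 :=
    Nat.exists_eq_succ_of_ne_zero (by rintro rfl; simp at hp)
  refine not_subsingleton_iff_nontrivial.2 h ?_
  rw [LocalizedModule.subsingleton_iff]
  intro m
  obtain ⟨⟨f, hf⟩, rfl⟩ := Submodule.mkQ_surjective _ m
  let u : Face (Fin (l + 1)) (l + 1) := ⟨Finset.univ, by simp⟩
  have hu (t : Face (Fin (l + 1)) (l + 1)) : t = u :=
    Subtype.ext ((Finset.card_eq_iff_eq_univ _).1 (by simpa using t.2))
  obtain ⟨r, n, hr⟩ : ∃ (r : R) (n : ℕ), (∏ j ∈ u.1, x j) ^ n • f u = LocalizedModule.mk r 1 := by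
    generalize f u = y
    induction y using LocalizedModule.induction_on with
    | h r d =>
      obtain ⟨_, n, rfl⟩ := d
      exact ⟨r, n, (LocalizedModule.smul'_mk _ _ _).trans
        (LocalizedModule.mk_cancel (⟨_, n, rfl⟩ : Submonoid.powers (∏ j ∈ u.1, x j)) r)⟩
  -- With `f = r / (∏ x j) ^ n` and `N = n * (k + 1)`, the relation for the `n`-th powers reads `s *
  -- (∏ x j) ^ (n * k) = ∑ c j * x j ^ N`. Hence `s • f` is the sum of the fractions `r * c j /
  -- (∏_{i ≠ j} x i) ^ N`, a coboundary.
  obtain ⟨s, hs, k, hk⟩ := exists_mul_prod_pow_mem_of_height_lt (fun j => x j ^ n) p hp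
  refine ⟨s, hs, ?_⟩
  obtain ⟨c, hc⟩ := (Ideal.mem_span_range_iff_exists_fun).1 hk
  rw [← map_smul]
  refine (Submodule.Quotient.mk_eq_zero _).2 ?_
  change s • f ∈ LinearMap.range (cechD R x l)
  have hlast : ∑ j, c j * x j ^ (n * (k + 1)) = s * (∏ j, x j) ^ (n * k) := by
    simp only [Finset.prod_pow] at hc
    simp only [pow_mul]
    exact hc
  set N := n * (k + 1) with hN
  -- The complement of a face `t` of size `l` is a single index, so the sum merely selects it; the
  -- sign cancels the one in the Čech differential.
  refine ⟨fun t => LocalizedModule.mk (∑ j ∈ t.1ᶜ, faceSign R Finset.univ j * (r * c j))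
    ⟨(∏ j ∈ t.1, x j) ^ N, N, rfl⟩, funext fun t => ?_⟩
  obtain rfl := hu t
  have hinj : Function.Injective fun z : CechLocalization R x u.1 => (∏ j ∈ u.1, x j) ^ N • z :=
    ((Module.End.isUnit_iff _).1 (isUnit_end_cechLocalization R x (Finset.Subset.refl u.1)
      ⟨_, N, rfl⟩)).1
  refine hinj ?_
  simp only
  rw [cechD_apply, Finset.smul_sum]
  have hterm (j : u.1) : (∏ j ∈ u.1, x j) ^ N • faceSign R u.1 j.1 •
      cechRestrict R x (Finset.erase_subset j.1 u.1) (LocalizedModule.mk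
        (∑ i ∈ (u.1.erase j.1)ᶜ, faceSign R Finset.univ i * (r * c i))
        ⟨(∏ i ∈ u.1.erase j.1, x i) ^ N, N, rfl⟩) =
      LocalizedModule.mk (r * (c j.1 * x j.1 ^ N)) 1 := by
    have h1 : (u.1.erase j.1)ᶜ = {j.1} := by
      ext i
      simp [u]
    have h2 : (∏ i ∈ u.1, x i) ^ N = x j.1 ^ N * (∏ i ∈ u.1.erase j.1, x i) ^ N := by
      rw [← Finset.mul_prod_erase u.1 x j.2, mul_pow]
    rw [h1, Finset.sum_singleton, h2, smul_comm, mul_smul, smul_cechRestrict_mk x (Finset.erase_subset j.1 u.1) _ ⟨_, N, rfl⟩,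
      LocalizedModule.smul'_mk, LocalizedModule.smul'_mk]
    congr 1
    simp only [smul_eq_mul]
    linear_combination (x j.1 ^ N * r * c j.1) * faceSign_mul_self (R := R) Finset.univ j.1
  rw [Finset.sum_congr rfl fun j _ => hterm j]
  have hsum : ∑ j : u.1, (LocalizedModule.mk (r * (c j.1 * x j.1 ^ N)) 1 :
      CechLocalization R x u.1) = LocalizedModule.mk (r * (s * (∏ j, x j) ^ (n * k))) 1 := by
    rw [← hlast, Finset.mul_sum]
    rw [Finset.sum_coe_sort u.1 fun j => (LocalizedModule.mk (r * (c j * x j ^ N)) 1 :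
      CechLocalization R x u.1)]
    exact (map_sum (LocalizedModule.mkLinearMap (Submonoid.powers (∏ j ∈ u.1, x j)) R)
      (fun j => r * (c j * x j ^ N)) u.1).symm
  have hpow : (∏ j ∈ u.1, x j) ^ N = (∏ j, x j) ^ (n * k) * (∏ j ∈ u.1, x j) ^ n := by
    rw [hN, mul_add, mul_one, pow_add]
  rw [hsum, Pi.smul_apply, hpow, smul_comm, mul_smul, hr, LocalizedModule.smul'_mk,
    LocalizedModule.smul'_mk]
  congr 1
  simp only [smul_eq_mul]
  ring

theorem HasLongRegularSequences.isCMHamiltonMarley [Nontrivial R]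
    (hR : HasLongRegularSequences R) : IsCMHamiltonMarley R := by
  intro l x hx
  have hht (i : ℕ) (hi : i ≤ l) :
      (i : ℕ∞) ≤ (Ideal.span (Set.range (x ∘ Fin.castLE hi))).height := by
    rcases Nat.eq_zero_or_pos i with rfl | hpos
    · simp
    rw [Ideal.height_eq_inf_minimalPrimes]
    refine le_iInf₂ fun p hp => ?_
    have := hp.1.1
    exact le_height_of_nontrivial_localizedModule_cechCohomology _ p
      ((hx i hi hpos).nontrivial p hp.1.2)
  have hspan (i : ℕ) (hi : i ≤ l) :
      Ideal.ofList ((List.ofFn x).take i) = Ideal.span (Set.range (x ∘ Fin.castLE hi)) := by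
    refine congrArg Ideal.span (Set.ext fun r => ?_)
    have h : (List.ofFn x).take i = List.ofFn (x ∘ Fin.castLE hi) := by
      refine List.ext_getElem (by simpa using hi) fun j _ _ => ?_
      simp
    rw [Set.mem_ofPred_eq, h, List.mem_ofFn]
    rfl
  refine ⟨⟨fun i hi => ?_⟩, ?_⟩
  · have hil : i < l := by simpa using hi
    rw [isSMulRegular_quotient_iff_mem_of_smul_mem]
    simp only [smul_eq_mul, Ideal.mul_top, hspan i hil.le, List.getElem_ofFn]
    intro m hm
    by_contra hmn
    let I : Ideal R :=
      Submodule.comap (LinearMap.mulRight R m) (Ideal.span (Set.range (x ∘ Fin.castLE hil.le)))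
    have hI : I ≠ ⊤ := fun h => hmn (by
      have h1 : (1 : R) ∈ I := h ▸ Submodule.mem_top
      have h2 : 1 * m ∈ Ideal.span (Set.range (x ∘ Fin.castLE hil.le)) := h1
      rwa [one_mul] at h2)
    obtain ⟨M, hM, hIM⟩ := Ideal.exists_le_maximal I hI
    obtain ⟨p, hp, -⟩ := Ideal.exists_minimalPrimes_le hIM
    -- As a weakly associated prime modulo the first `i` elements, `p` has height at most `i`; yet
    -- it contains the first `i + 1` elements, the last one because it kills `m`.
    have h1 := hR.height_le_of_mem_minimalPrimes (hht i hil.le) (m := m) (fun r => Iff.rfl) hp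
    have h2 : Ideal.span (Set.range (x ∘ Fin.castLE (Nat.succ_le_of_lt hil))) ≤ p := by
      rw [Ideal.span_le]
      rintro _ ⟨j, rfl⟩
      refine hp.1.2 ?_
      change x _ * m ∈ Ideal.span _
      induction j using Fin.lastCases with
      | last => exact hm
      | cast j => exact Ideal.mul_mem_right _ _ (Ideal.subset_span ⟨j, rfl⟩)
    have h3 := ((hht (i + 1) hil).trans (Ideal.height_mono h2)).trans h1
    rw [Nat.cast_le] at h3
    omega
  · rw [smul_eq_mul, Ideal.mul_top]
    have h1 := hspan l le_rfl
    rw [List.take_of_length_le (by simp)] at h1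
    rw [h1]
    rcases Nat.eq_zero_or_pos l with rfl | hpos
    · simp
    · exact (hx l le_rfl hpos).ne_top.symm

end Parameters

/-! ### Heights and regular sequences along integral and flat maps -/

section Heights

/-- The height of an ideal is at most that of its contraction along an integral homomorphism. -/
theorem height_le_height_comap_of_isIntegral {R S : Type*} [CommRing R] [CommRing S] {φ : R →+* S}
    (hφ : φ.IsIntegral) (b : Ideal S) : b.height ≤ (b.comap φ).height := by
  algebraize [φ]
  rw [Ideal.height_eq_inf_minimalPrimes (b.comap φ)]
  refine le_iInf₂ fun q hq => ?_
  have := hq.1.1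
  obtain ⟨Q, hbQ, hQ, rfl⟩ := Ideal.exists_ideal_over_prime_of_isIntegral q b hq.1.2
  refine (Ideal.height_mono hbQ).trans ?_
  -- By incomparability, chains below `Q` contract to strict chains below the prime it lies over.
  have hmono : StrictMono (PrimeSpectrum.comap (algebraMap R S)) := fun I J h =>
    Ideal.IsIntegral.comap_lt_comap (I := I.asIdeal) (J := J.asIdeal) h
  have h1 := Order.height_le_height_apply_of_strictMono _ hmono ⟨Q, hQ⟩
  rwa [← PrimeSpectrum.height_eq_orderHeight, ← PrimeSpectrum.height_eq_orderHeight] at h1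

/-- Killing one element of a prime lowers its height by at most one. -/
def HeightDropsByAtMostOne (T : Type*) [CommRing T] (f : T) : Prop :=
  ∀ (Q : Ideal T) [Q.IsPrime] (n : ℕ), f ∈ Q → ((n + 1 : ℕ) : ℕ∞) ≤ Q.height →
    (n : ℕ∞) ≤ (Q.map (Ideal.Quotient.mk (Ideal.span {f}))).height

/-- Because `f ∈ c`, contracting `c` to `B` amounts to contracting its image in `T ⧸ (f)` along an
integral map. -/
lemma HeightDropsByAtMostOne.le_height_comap {B T : Type*} [CommRing B] [CommRing T] {f : T}
    (hf : HeightDropsByAtMostOne T f) {ψ : B →+* T}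
    (hψ : ((Ideal.Quotient.mk (Ideal.span {f})).comp ψ).IsIntegral) {c : Ideal T} (hfc : f ∈ c)
    {n : ℕ} (hc : ((n + 1 : ℕ) : ℕ∞) ≤ c.height) : (n : ℕ∞) ≤ (c.comap ψ).height := by
  set π := Ideal.Quotient.mk (Ideal.span {f}) with hπ
  have hker : Ideal.span {f} ≤ c := (Ideal.span_singleton_le_iff_mem _).2 hfc
  have h1 : c.comap ψ = (c.map π).comap (π.comp ψ) := by
    rw [← Ideal.comap_comap, Ideal.comap_map_of_surjective _ Ideal.Quotient.mk_surjective,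
      ← RingHom.ker_eq_comap_bot, Ideal.mk_ker, sup_eq_left.2 hker]
  rw [h1]
  refine le_trans ?_ (height_le_height_comap_of_isIntegral hψ _)
  rw [Ideal.height_eq_inf_minimalPrimes]
  refine le_iInf₂ fun q hq => ?_
  have := hq.1.1
  have hcq : c ≤ q.comap π := Ideal.map_le_iff_le_comap.1 hq.1.2
  have h2 := hf (q.comap π) n (hcq hfc) (hc.trans (Ideal.height_mono hcq))
  rwa [Ideal.map_comap_of_surjective _ Ideal.Quotient.mk_surjective] at h2

lemma isWeaklyRegular_cons_map {B T : Type*} [CommRing B] [CommRing T] {f : T}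
    (hf : IsSMulRegular T f) {ψ : B →+* T}
    (hψ : ((Ideal.Quotient.mk (Ideal.span {f})).comp ψ).Flat) {rs : List B}
    (hrs : IsWeaklyRegular B rs) : IsWeaklyRegular T (f :: rs.map ψ) := by
  rw [isWeaklyRegular_cons_iff]
  refine ⟨hf, ?_⟩
  have h1 : IsWeaklyRegular (T ⧸ Ideal.span {f})
      ((rs.map ψ).map (algebraMap T (T ⧸ Ideal.span {f}))) := by
    let := ((Ideal.Quotient.mk (Ideal.span {f})).comp ψ).toAlgebra
    have : Module.Flat B (T ⧸ Ideal.span {f}) := hψ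
    have h2 := hrs.of_flat (S := T ⧸ Ideal.span {f})
    rw [List.map_map]
    exact h2
  rw [isWeaklyRegular_map_algebraMap_iff] at h1
  have heq : f • (⊤ : Submodule T T) = Ideal.span {f} := by
    rw [← Submodule.ideal_span_singleton_smul, smul_eq_mul, Ideal.mul_top]
  exact ((Submodule.quotEquivOfEq _ _ heq).isWeaklyRegular_congr (rs.map ψ)).2 h1

end Heights

/-! ### Killing one polynomial in arbitrarily many variables -/

section PolynomialHeights

open MvPolynomial

variable {σ : Type*} {k : Type*} [Field k]

/-- `k[σ]` is a polynomial ring over `k[s]` in the remaining variables, hence free. -/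
lemma flat_rename_subtype (s : Finset σ) :
    (rename (R := k) (Subtype.val : s → σ)).toRingHom.Flat := by
  classical
  let e : MvPolynomial {a // a ∉ s} (MvPolynomial s k) ≃ₐ[k] MvPolynomial σ k :=
    (sumAlgEquiv k {a // a ∉ s} s).symm.trans
      (renameEquiv k ((Equiv.sumComm _ _).trans (Equiv.sumCompl (· ∈ s))))
  have h : (rename (R := k) (Subtype.val : s → σ)).toRingHom =
      e.toRingEquiv.toRingHom.comp (C (σ := {a // a ∉ s}) (R := MvPolynomial s k)) := by
    refine MvPolynomial.ringHom_ext (fun r => ?_) fun i => ?_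
    · simp [e]
    · simp [e]
  rw [h]
  refine RingHom.Flat.comp ?_ (RingHom.Flat.of_bijective e.bijective)
  exact RingHom.flat_algebraMap_iff.2 inferInstance

lemma exists_finset_mem_range_rename {α : Type*} [Finite α] (a : α → MvPolynomial σ k) :
    ∃ s : Finset σ, ∀ i, a i ∈ Set.range (rename (R := k) (Subtype.val : s → σ)) := by
  classical
  have := Fintype.ofFinite α
  refine ⟨Finset.univ.biUnion fun i => (a i).vars, fun i => ?_⟩
  refine exists_rename_eq_of_vars_subset_range _ _ Subtype.val_injective fun j hj => ?_
  rw [Subtype.range_coe_subtype]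
  exact Finset.mem_biUnion.2 ⟨i, Finset.mem_univ _, hj⟩

/-- The Noetherian height bound is used in `k[s]`, where the finite set `s` contains the variables
of `f` and of elements separating a chain of length `n + 1` below `Q`. The chain of length `n`
obtained there modulo `f` is lifted to one ending at `Q` by going-down for the flat extension `k[s]
→ k[σ]`. -/
theorem heightDropsByAtMostOne_mvPolynomial (f : MvPolynomial σ k) :
    HeightDropsByAtMostOne (MvPolynomial σ k) f := by
  intro Q _ n hfQ hn
  have hn' : ((n + 1 : ℕ) : ℕ∞) ≤ Order.height (⟨Q, inferInstance⟩ : PrimeSpectrum _) := by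
    rwa [← PrimeSpectrum.height_eq_orderHeight]
  obtain ⟨c, hcQ, hcn⟩ := Order.exists_series_of_le_height _ hn'
  have hex (i : Fin c.length) :
      ∃ a, a ∈ (c i.succ).asIdeal ∧ a ∉ (c i.castSucc).asIdeal :=
    SetLike.not_le_iff_exists.1 (c.step i).not_ge
  choose a ha ha' using hex
  obtain ⟨s, hs⟩ := exists_finset_mem_range_rename (fun i : Option (Fin c.length) => i.elim f a)
  let φ : MvPolynomial s k →+* MvPolynomial σ k :=
    (rename (R := k) (Subtype.val : s → σ)).toRingHom
  have hflat : φ.Flat := flat_rename_subtype s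
  algebraize [φ]
  obtain ⟨f₀, hf₀⟩ : ∃ f₀, φ f₀ = f := hs none
  -- The contracted chain is strict because `s` contains the variables of the witnesses `a`.
  let c₀ : LTSeries (PrimeSpectrum (MvPolynomial s k)) :=
    { length := c.length
      toFun := fun i => PrimeSpectrum.comap φ (c i)
      step := fun i => by
        refine lt_of_le_not_ge (Ideal.comap_mono (c.step i).le) fun hle => ?_
        obtain ⟨b, hb⟩ := hs (some i)
        have hb' : φ b = a i := hb
        have h1 : b ∈ (PrimeSpectrum.comap φ (c i.castSucc)).asIdeal := hle (by
          change φ b ∈ (c i.succ).asIdeal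
          rw [hb']
          exact ha i)
        refine ha' i ?_
        rw [← hb']
        exact h1 }
  let q : Ideal (MvPolynomial s k) := Q.comap φ
  have hq : c₀.last = ⟨q, inferInstance⟩ := by
    change PrimeSpectrum.comap φ c.last = _
    rw [hcQ]
    rfl
  have hf₀q : f₀ ∈ q := by
    change φ f₀ ∈ Q
    rwa [hf₀]
  have hqn : ((n + 1 : ℕ) : ℕ∞) ≤ q.height := by
    have h1 := Order.length_le_height_last (p := c₀)
    rw [hq, ← PrimeSpectrum.height_eq_orderHeight] at h1
    rwa [← hcn]
  have hdrop := hqn.trans (Ideal.height_le_height_add_one_of_mem hf₀q)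
  rw [Nat.cast_add, Nat.cast_one, ENat.add_le_add_iff_right ENat.one_ne_top] at hdrop
  have hprime : (q.map (Ideal.Quotient.mk (Ideal.span {f₀}))).IsPrime :=
    Ideal.isPrime_map_quotientMk_of_isPrime ((Ideal.span_singleton_le_iff_mem _).2 hf₀q)
  have hdrop' : (n : ℕ∞) ≤ Order.height
      (⟨q.map (Ideal.Quotient.mk (Ideal.span {f₀})), hprime⟩ : PrimeSpectrum _) := by
    rwa [← PrimeSpectrum.height_eq_orderHeight]
  obtain ⟨d, hdq, hdn⟩ := Order.exists_series_of_le_height _ hdrop'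
  have hmono : StrictMono (PrimeSpectrum.comap (Ideal.Quotient.mk (Ideal.span {f₀}))) :=
    (Subtype.strictMono_coe _).comp
      (Ideal.primeSpectrumQuotientOrderIsoZeroLocus (Ideal.span {f₀})).strictMono
  let d₀ := d.map _ hmono
  have hd₀ : d₀.last.asIdeal = q := by
    change (PrimeSpectrum.comap _ d.last).asIdeal = q
    rw [hdq]
    change (q.map (Ideal.Quotient.mk (Ideal.span {f₀}))).comap _ = q
    rw [Ideal.comap_map_of_surjective _ Ideal.Quotient.mk_surjective, ← RingHom.ker_eq_comap_bot,
      Ideal.mk_ker, sup_eq_left, Ideal.span_singleton_le_iff_mem]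
    exact hf₀q
  have hlies : Q.LiesOver d₀.last.asIdeal := ⟨by rw [hd₀]; rfl⟩
  obtain ⟨D, hDlen, hDlast, hDd⟩ := Ideal.exists_ltSeries_of_hasGoingDown d₀ Q
  -- The smallest lifted prime lies over one containing `f₀`, so the whole lifted chain lives over
  -- `(f)`.
  have hhead : f ∈ D.head.asIdeal := by
    have h1 : PrimeSpectrum.comap φ D.head = d₀.head := by
      rw [← D.toList_getElem_zero_eq_head, ← d₀.toList_getElem_zero_eq_head,
        ← List.getElem_of_eq hDd (by simp), List.getElem_map]
      rfl
    have h2 : f₀ ∈ d₀.head.asIdeal := by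
      change Ideal.Quotient.mk (Ideal.span {f₀}) f₀ ∈ d.head.asIdeal
      rw [Ideal.Quotient.eq_zero_iff_mem.2 (Ideal.mem_span_singleton_self f₀)]
      exact Submodule.zero_mem _
    rw [← h1] at h2
    rw [← hf₀]
    exact h2
  have hmem (i : Fin (D.length + 1)) :
      D i ∈ PrimeSpectrum.zeroLocus (Ideal.span {f} : Ideal (MvPolynomial σ k)) :=
    (Ideal.span_singleton_le_iff_mem _).2 (D.head_le i hhead)
  let E : LTSeries (PrimeSpectrum (MvPolynomial σ k ⧸ Ideal.span {f})) :=
    { length := D.length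
      toFun := fun i => (Ideal.primeSpectrumQuotientOrderIsoZeroLocus _).symm ⟨D i, hmem i⟩
      step := fun i => (Ideal.primeSpectrumQuotientOrderIsoZeroLocus _).symm.strictMono (D.step i) }
  have hE : E.last.asIdeal = Q.map (Ideal.Quotient.mk (Ideal.span {f})) := by
    have h1 : D.last.asIdeal = Q := congrArg PrimeSpectrum.asIdeal hDlast
    rw [← h1]
    rfl
  have h1 := Order.length_le_height_last (p := E)
  rw [← PrimeSpectrum.height_eq_orderHeight, hE] at h1
  have h2 : E.length = n := hDlen.trans hdn
  rwa [h2] at h1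

end PolynomialHeights

/-! ### Making a polynomial monic in a fresh variable -/

section FreshVariable

open MvPolynomial

variable (k : Type*) [Field k] (N : ℕ) (r : ℕ → ℕ)

/-- The homomorphism with `X_i ↦ X_i + Y ^ (r i)` for `i < N`, `X_N ↦ Y`, and `X_i ↦ X_{i-1}` for
`i > N`. -/
noncomputable def shearHom : MvPolynomial ℕ k →+* Polynomial (MvPolynomial ℕ k) :=
  eval₂Hom (Polynomial.C.comp C) fun i =>
    if i < N then Polynomial.X ^ r i + Polynomial.C (X i)
    else if i = N then Polynomial.X else Polynomial.C (X (i - 1))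

/-- The inverse of `shearHom`. -/
noncomputable def shearInv : Polynomial (MvPolynomial ℕ k) →+* MvPolynomial ℕ k :=
  Polynomial.eval₂RingHom
    (eval₂Hom C fun i => if i < N then X i - X N ^ r i else X (i + 1)) (X N)

/-- The isomorphism `k[X_0, X_1, …] ≃ k[X_0, X_1, …][Y]` given by `shearHom`. -/
noncomputable def shearEquiv : MvPolynomial ℕ k ≃+* Polynomial (MvPolynomial ℕ k) :=
  RingEquiv.ofRingHom (shearHom k N r) (shearInv k N r)
    (by
      refine Polynomial.ringHom_ext' (MvPolynomial.ringHom_ext (fun c => ?_) fun i => ?_) ?_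
      · simp [shearInv, shearHom]
      · by_cases h : i < N
        · simp [shearInv, shearHom, h]
        · simp [shearInv, shearHom, h, show ¬ i + 1 < N by omega, show i + 1 ≠ N by omega]
      · simp [shearInv, shearHom])
    (by
      refine MvPolynomial.ringHom_ext (fun c => ?_) fun i => ?_
      · simp [shearInv, shearHom]
      rcases lt_trichotomy i N with h | rfl | h
      · simp [shearInv, shearHom, h]
      · simp [shearInv, shearHom]
      · simp [shearInv, shearHom, show ¬ i < N by omega, show i ≠ N by omega,
          show ¬ i - 1 < N by omega, show i - 1 + 1 = i by omega])

variable {k N r}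

/-- Each factor `Y ^ r i + X i` is monic in `Y`, as `r i ≠ 0`; degrees add up and only `c` is left
in front. -/
lemma shearHom_monomial (hr : ∀ i, r i ≠ 0) {s : ℕ →₀ ℕ} (hs : ∀ i ∈ s.support, i < N) {c : k}
    (hc : c ≠ 0) :
    (shearHom k N r (monomial s c)).natDegree = ∑ i ∈ s.support, s i * r i ∧
      (shearHom k N r (monomial s c)).leadingCoeff = C c := by
  have h1 : shearHom k N r (monomial s c) = Polynomial.C (C c) *
      ∏ i ∈ s.support, (Polynomial.X ^ r i + Polynomial.C (X i)) ^ s i := by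
    rw [shearHom, coe_eval₂Hom, eval₂_monomial, Finsupp.prod]
    refine congrArg _ (Finset.prod_congr rfl fun i hi => ?_)
    rw [if_pos (hs i hi)]
  have hmon (i : ℕ) : ((Polynomial.X ^ r i + Polynomial.C (X i) :
      Polynomial (MvPolynomial ℕ k)) ^ s i).Monic :=
    (Polynomial.monic_X_pow_add_C _ (hr i)).pow _
  have hprod := Polynomial.monic_prod_of_monic s.support _ fun i _ => hmon i
  rw [h1]
  constructor
  · rw [Polynomial.natDegree_C_mul (by simpa using hc),
      Polynomial.natDegree_prod_of_monic _ _ fun i _ => hmon i]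
    refine Finset.sum_congr rfl fun i _ => ?_
    rw [(Polynomial.monic_X_pow_add_C _ (hr i)).natDegree_pow, Polynomial.natDegree_X_pow_add_C]
  · rw [Polynomial.leadingCoeff_mul_monic hprod, Polynomial.leadingCoeff_C]

/-- Exponents below `D` are the base-`D` digits of the weighted sum. -/
lemma sum_mul_pow_injOn {D : ℕ} (hD : 1 < D) {s t : ℕ →₀ ℕ} (hs : ∀ i ∈ s.support, i < N)
    (ht : ∀ i ∈ t.support, i < N) (hsD : ∀ i, s i < D) (htD : ∀ i, t i < D)
    (h : ∑ i ∈ s.support, s i * D ^ i = ∑ i ∈ t.support, t i * D ^ i) : s = t := by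
  have key (s : ℕ →₀ ℕ) (hs : ∀ i ∈ s.support, i < N) :
      ∑ i ∈ s.support, s i * D ^ i = Nat.ofDigits D (List.ofFn fun i : Fin N => s i) := by
    rw [Nat.ofDigits_eq_sum_mapIdx, List.mapIdx_eq_ofFn, List.sum_ofFn]
    rw [Finset.sum_subset (s₂ := Finset.range N) (fun i hi => Finset.mem_range.2 (hs i hi))
      (fun i _ hi => by rw [Finsupp.notMem_support_iff.1 hi, zero_mul]),
      ← Fin.sum_univ_eq_sum_range (fun i => s i * D ^ i)]
    exact Fintype.sum_equiv (finCongr (by simp)) _ _ fun i => by simp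
  rw [key s hs, key t ht] at h
  have h1 := Nat.ofDigits_inj_of_len_eq hD (by simp)
    (by simpa [List.mem_ofFn] using fun i => hsD _) (by simpa [List.mem_ofFn] using fun i => htD _) h
  have h2 := List.ofFn_injective h1
  ext i
  by_cases hi : i < N
  · exact congrFun h2 ⟨i, hi⟩
  · rw [Finsupp.notMem_support_iff.1 fun h => hi (hs i h),
      Finsupp.notMem_support_iff.1 fun h => hi (ht i h)]

/-- A nonzero polynomial becomes monic up to a unit in a fresh variable after a suitable
shear. -/
theorem exists_isUnit_leadingCoeff_shearEquiv {f : MvPolynomial ℕ k} (hf : f ≠ 0) :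
    ∃ (N : ℕ) (r : ℕ → ℕ), IsUnit (shearEquiv k N r f).leadingCoeff := by
  classical
  -- The variable `X N` lies beyond those of `f`, so it can serve as `Y`. The base `D` exceeds every
  -- exponent in `f`, and adding `2` keeps it above `1` for constant `f`.
  let N := f.vars.sup id + 1
  let D := f.totalDegree + 2
  let r : ℕ → ℕ := fun i => D ^ i
  have hr (i : ℕ) : r i ≠ 0 := pow_ne_zero _ (by simp [D])
  have hN : ∀ s ∈ f.support, ∀ i ∈ s.support, i < N := fun s hs i hi =>
    Nat.lt_succ_of_le (Finset.le_sup (f := id) ((mem_vars_iff_mem_support i).2 ⟨s, hs, hi⟩))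
  have hD : ∀ s ∈ f.support, ∀ i, s i < D := fun s hs i =>
    ((monomial_le_degreeOf i hs).trans (degreeOf_le_totalDegree f i)).trans_lt (by simp [D])
  let w : (ℕ →₀ ℕ) → ℕ := fun s => ∑ i ∈ s.support, s i * r i
  -- Distinct monomials have distinct weights, so `m` alone attains the top degree in `Y` and its
  -- coefficient is the leading one.
  obtain ⟨m, hm, hmax⟩ := Finset.exists_max_image f.support w (support_nonempty.2 hf)
  refine ⟨N, r, ?_⟩
  have hsplit : shearEquiv k N r f = shearHom k N r (monomial m (f.coeff m)) +
      ∑ s ∈ f.support.erase m, shearHom k N r (monomial s (f.coeff s)) := by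
    change shearHom k N r f = _
    conv_lhs => rw [f.as_sum, map_sum, ← Finset.add_sum_erase _ _ hm]
  have hmc := mem_support_iff.1 hm
  obtain ⟨hdeg, hlead⟩ := shearHom_monomial hr (hN m hm) hmc
  have hne : shearHom k N r (monomial m (f.coeff m)) ≠ 0 := by
    rw [← Polynomial.leadingCoeff_ne_zero, hlead]
    simpa using hmc
  have hlt : (∑ s ∈ f.support.erase m, shearHom k N r (monomial s (f.coeff s))).degree <
      (shearHom k N r (monomial m (f.coeff m))).degree := by
    rw [Polynomial.degree_eq_natDegree hne, ← Polynomial.mem_degreeLT]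
    refine Submodule.sum_mem _ fun s hs => ?_
    obtain ⟨hsm, hs⟩ := Finset.mem_erase.1 hs
    rw [Polynomial.mem_degreeLT]
    refine Polynomial.degree_le_natDegree.trans_lt (Nat.cast_lt.2 ?_)
    rw [hdeg, (shearHom_monomial hr (hN s hs) (mem_support_iff.1 hs)).1]
    exact lt_of_le_of_ne (hmax s hs) fun h => hsm
      (sum_mul_pow_injOn (by simp [D]) (hN s hs) (hN m hm) (hD s hs) (hD m hm) h)
  rw [hsplit, Polynomial.leadingCoeff_add_of_degree_lt' hlt, hlead]
  exact (Ne.isUnit hmc).map C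

end FreshVariable

/-! ### Quotients by a polynomial with unit leading coefficient -/

section MonicQuotient

open Polynomial

/-- Rescaling by a unit makes `F` monic without changing the ideal, and a monic quotient is finite
free over `B`. -/
lemma isIntegral_and_flat_of_isUnit_leadingCoeff {B : Type*} [CommRing B] {F : B[X]}
    (hF : IsUnit F.leadingCoeff) :
    ((Ideal.Quotient.mk (Ideal.span {F})).comp C).IsIntegral ∧
      ((Ideal.Quotient.mk (Ideal.span {F})).comp C).Flat := by
  obtain ⟨c, hc⟩ := hF
  have hmonic : (C (↑c⁻¹ : B) * F).Monic := by
    refine monic_C_mul_of_mul_leadingCoeff_eq_one ?_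
    rw [← hc, Units.inv_mul]
  have hspan : Ideal.span {F} = Ideal.span {C (↑c⁻¹ : B) * F} :=
    (Ideal.span_singleton_mul_left_unit (c⁻¹.isUnit.map C) F).symm
  rw [hspan]
  have h1 := hmonic.free_adjoinRoot
  have h2 := hmonic.finite_adjoinRoot
  constructor
  · exact algebraMap_isIntegral_iff.2
      (inferInstance : Algebra.IsIntegral B (AdjoinRoot (C (↑c⁻¹ : B) * F)))
  · exact (RingHom.flat_algebraMap_iff (R := B) (S := AdjoinRoot (C (↑c⁻¹ : B) * F))).2 inferInstance

end MonicQuotient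

/-! ### Long regular sequences in the polynomial ring -/

section PolynomialRing

variable {k : Type*} [Field k]

lemma exists_isIntegral_and_flat {f : MvPolynomial ℕ k} (hf : f ≠ 0) :
    ∃ ψ : MvPolynomial ℕ k →+* MvPolynomial ℕ k,
      ((Ideal.Quotient.mk (Ideal.span {f})).comp ψ).IsIntegral ∧
        ((Ideal.Quotient.mk (Ideal.span {f})).comp ψ).Flat := by
  obtain ⟨N, r, h⟩ := exists_isUnit_leadingCoeff_shearEquiv hf
  let e := shearEquiv k N r
  obtain ⟨h1, h2⟩ := isIntegral_and_flat_of_isUnit_leadingCoeff h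
  let e' : (Polynomial (MvPolynomial ℕ k) ⧸ Ideal.span {e f}) ≃+*
      (MvPolynomial ℕ k ⧸ Ideal.span {f}) :=
    Ideal.quotientEquiv _ _ e.symm (by simp [Ideal.map_span])
  have heq : (Ideal.Quotient.mk (Ideal.span {f})).comp
      (e.symm.toRingHom.comp Polynomial.C) =
      e'.toRingHom.comp ((Ideal.Quotient.mk (Ideal.span {e f})).comp Polynomial.C) := by
    ext <;> rfl
  refine ⟨e.symm.toRingHom.comp Polynomial.C, ?_, ?_⟩
  · rw [heq]
    exact RingHom.IsIntegral.trans _ _ h1 (RingHom.isIntegral_of_surjective _ e'.surjective)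
  · rw [heq]
    exact h2.comp (RingHom.Flat.of_bijective e'.bijective)

/-- The source of `ψ` is again the polynomial ring in countably many variables, so the induction on
`n`, over all ideals at once, never leaves this ring. -/
theorem hasLongRegularSequences_mvPolynomial : HasLongRegularSequences (MvPolynomial ℕ k) := by
  intro c n
  induction n generalizing c with
  | zero => exact fun _ => ⟨[], rfl, by simp, IsWeaklyRegular.nil _ _⟩
  | succ n ih =>
    intro hc
    obtain ⟨f, hfc, hf⟩ : ∃ f ∈ c, f ≠ 0 := by
      refine Submodule.exists_mem_ne_zero_of_ne_bot fun h => ?_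
      rw [h, Ideal.height_bot] at hc
      simp at hc
    obtain ⟨ψ, hint, hflat⟩ := exists_isIntegral_and_flat hf
    obtain ⟨rs, hlen, hrs, hreg⟩ := ih _
      ((heightDropsByAtMostOne_mvPolynomial f).le_height_comap hint hfc hc)
    refine ⟨f :: rs.map ψ, by simp [hlen], ?_,
      isWeaklyRegular_cons_map (IsSMulRegular.of_ne_zero hf) hflat hreg⟩
    intro y hy
    rcases List.mem_cons.1 hy with rfl | hy
    · exact hfc
    · obtain ⟨z, hz, rfl⟩ := List.mem_map.1 hy
      exact hrs z hz

end PolynomialRing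

/-! ### Transfer to the Veronese subring -/

section Veronese

open MvPolynomial

variable {k : Type u} [Field k] {d : ℕ}

lemma dvd_degree_of_mem_veronese {p : MvPolynomial ℕ k} (hp : p ∈ veronese k d) :
    ∀ n ∈ p.support, d ∣ n.degree := by
  classical
  induction hp using Algebra.adjoin_induction with
  | mem x hx =>
    obtain ⟨s, rfl, rfl⟩ := hx
    intro n hn
    rw [Finset.mem_singleton.1 (support_monomial_subset hn)]
  | algebraMap c =>
    intro n hn
    rw [algebraMap_eq, C_apply] at hn
    rw [Finset.mem_singleton.1 (support_monomial_subset hn)]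
    simp
  | add x y _ _ hx hy =>
    intro n hn
    rcases Finset.mem_union.1 (support_add hn) with h | h
    · exact hx n h
    · exact hy n h
  | mul x y _ _ hx hy =>
    intro n hn
    obtain ⟨a, ha, b, hb, rfl⟩ := Finset.mem_add.1 (support_mul x y hn)
    rw [map_add]
    exact dvd_add (hx a ha) (hy b hb)

/-- A monomial of degree `d * (m + 1)` has a divisor of degree exactly `d`; splitting it off leaves
degree `d * m`. -/
lemma monomial_mem_veronese {n : ℕ →₀ ℕ} (hn : d ∣ n.degree) :
    (monomial n (1 : k)) ∈ veronese k d := by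
  obtain ⟨m, hm⟩ := hn
  induction m generalizing n with
  | zero =>
    rw [mul_zero, Finsupp.degree_eq_zero_iff] at hm
    rw [hm]
    exact one_mem _
  | succ m ih =>
    obtain ⟨t, htn, ht⟩ := Finsupp.exists_le_degree_eq n d
      (hm ▸ Nat.le_mul_of_pos_right _ m.succ_pos)
    have hsplit : n = t + (n - t) := (add_tsub_cancel_of_le htn).symm
    have hdeg : (n - t).degree = d * m := by
      have h1 := congrArg Finsupp.degree hsplit
      rw [map_add, ht, hm, mul_add, mul_one] at h1
      omega
    have h2 : (monomial n (1 : k)) = monomial t 1 * monomial (n - t) 1 := by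
      rw [monomial_mul, one_mul, ← hsplit]
    rw [h2]
    exact mul_mem (Algebra.subset_adjoin ⟨t, ht, rfl⟩) (ih hdeg)

lemma expand_mem_veronese (p : MvPolynomial ℕ k) : expand d p ∈ veronese k d := by
  induction p using MvPolynomial.induction_on with
  | C a =>
    rw [expand_C]
    exact Subalgebra.algebraMap_mem _ a
  | add p q hp hq =>
    rw [map_add]
    exact add_mem hp hq
  | mul_X p i hp =>
    rw [map_mul, expand_X]
    refine mul_mem hp (Algebra.subset_adjoin ⟨Finsupp.single i d, by simp, ?_⟩)
    rw [X_pow_eq_monomial]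

variable (k d) in
/-- The homomorphism `X_i ↦ X_i ^ d` from the polynomial ring to its Veronese subring. -/
noncomputable def toVeronese : MvPolynomial ℕ k →ₐ[k] veronese k d :=
  (expand d).codRestrict (veronese k d) expand_mem_veronese

/-- Each `X i` is a root of `T ^ d - X i ^ d`, so the whole polynomial ring is integral over the
`d`-th powers; the equations hold in the subring since its inclusion is injective. -/
lemma isIntegral_toVeronese (hd : 1 ≤ d) : (toVeronese k d).toRingHom.IsIntegral := by
  have hexp : (expand (σ := ℕ) (R := k) d).toRingHom.IsIntegral := by
    intro p
    induction p using MvPolynomial.induction_on with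
    | C a =>
      have h := RingHom.isIntegralElem_map (expand (σ := ℕ) (R := k) d).toRingHom (x := C a)
      have h1 : (expand (σ := ℕ) (R := k) d).toRingHom (C a) = C a := expand_C _ _
      rwa [h1] at h
    | add p q hp hq => exact hp.add _ hq
    | mul_X p i hp =>
      refine hp.mul _ ⟨Polynomial.X ^ d - Polynomial.C (X i),
        Polynomial.monic_X_pow_sub_C _ (by omega), ?_⟩
      simp
  intro p
  obtain ⟨q, hq, hqp⟩ := hexp p.1
  refine ⟨q, hq, Subtype.val_injective ?_⟩
  have h1 := Polynomial.hom_eval₂ q (toVeronese k d).toRingHom (veronese k d).val.toRingHom p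
  exact h1.trans hqp

/-- The exponents of the monomials which form a basis of the Veronese subring over the subring
generated by the `d`-th powers of the variables. -/
abbrev VeroneseIndex (d : ℕ) : Type := {e : ℕ →₀ ℕ // (∀ i, e i < d) ∧ d ∣ e.degree}

/-- Division of exponents by `d` has a unique remainder, so distinct `e` contribute to disjoint sets
of monomials. -/
lemma coeff_expand_mul_monomial (hd : 1 ≤ d) (p : MvPolynomial ℕ k) (e e' : VeroneseIndex d)
    (s : ℕ →₀ ℕ) [Decidable (e = e')] :
    coeff (d • s + e'.1) (expand d p * monomial e.1 1) = if e = e' then coeff s p else 0 := by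
  rw [coeff_mul_monomial', mul_one]
  split_ifs with h1 h2 h2
  · rw [h2, add_tsub_cancel_right]
    exact coeff_expand_smul _ (by omega) _ _
  · obtain ⟨i, hi⟩ : ∃ i, e.1 i ≠ e'.1 i := by
      by_contra! hcon
      exact h2 (Subtype.ext (Finsupp.ext hcon))
    refine coeff_expand_of_not_dvd (i := i) _ fun ⟨t, ht⟩ => hi ?_
    have h3 : e.1 i ≤ d * s i + e'.1 i := by simpa using h1 i
    have h4 : d * s i + e'.1 i - e.1 i = d * t := by simpa using ht
    have h5 : e.1 i + d * t = e'.1 i + d * s i := by omega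
    have h6 := congrArg (· % d) h5
    simpa [Nat.add_mul_mod_self_left, Nat.mod_eq_of_lt (e.2.1 i),
      Nat.mod_eq_of_lt (e'.2.1 i)] using h6
  · exact absurd (h2 ▸ le_add_self) h1
  · rfl

/-- The monomials with exponents below `d` and degree divisible by `d` form a basis. They span
because the entrywise remainder modulo `d` of an exponent of degree divisible by `d` again has
degree divisible by `d`. -/
lemma flat_toVeronese (hd : 1 ≤ d) : (toVeronese k d).toRingHom.Flat := by
  classical
  algebraize [(toVeronese k d).toRingHom]
  let b : VeroneseIndex d → veronese k d := fun e => ⟨monomial e.1 1, monomial_mem_veronese e.2.2⟩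
  let L := Finsupp.linearCombination (MvPolynomial ℕ k) b
  have hL (v : VeroneseIndex d →₀ MvPolynomial ℕ k) :
      (L v : MvPolynomial ℕ k) = ∑ e ∈ v.support, expand d (v e) * monomial e.1 1 := by
    change (veronese k d).val (L v) = _
    rw [Finsupp.linearCombination_apply, Finsupp.sum, map_sum]
    rfl
  have hcoeff (v : VeroneseIndex d →₀ MvPolynomial ℕ k) (e : VeroneseIndex d) (s : ℕ →₀ ℕ) :
      coeff (d • s + e.1) (L v : MvPolynomial ℕ k) = coeff s (v e) := by
    rw [hL, coeff_sum]
    simp_rw [coeff_expand_mul_monomial hd]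
    rw [Finset.sum_ite_eq']
    split_ifs with h
    · rfl
    · rw [Finsupp.notMem_support_iff.1 h, coeff_zero]
  have hinj : Function.Injective L := by
    rw [injective_iff_map_eq_zero]
    intro v hv
    ext e s
    rw [← hcoeff, hv]
    simp
  have hsurj : Function.Surjective L := by
    rw [← LinearMap.range_eq_top, eq_top_iff]
    rintro ⟨p, hp⟩ -
    have hmon (n : p.support) :
        ∃ v, (L v : MvPolynomial ℕ k) = monomial n.1 (coeff n.1 p) := by
      have hn : d • n.1.mapRange (· / d) (Nat.zero_div d) +
          n.1.mapRange (· % d) (Nat.zero_mod d) = n.1 := by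
        ext i
        simp [Nat.div_add_mod]
      have hdvd : d ∣ (n.1.mapRange (· % d) (Nat.zero_mod d)).degree := by
        have h1 := dvd_degree_of_mem_veronese hp n.1 n.2
        rw [← hn, map_add, map_nsmul, smul_eq_mul] at h1
        exact (Nat.dvd_add_right (dvd_mul_right _ _)).1 h1
      refine ⟨Finsupp.single ⟨n.1.mapRange (· % d) (Nat.zero_mod d),
        fun i => by simpa using Nat.mod_lt _ hd, hdvd⟩
        (monomial (n.1.mapRange (· / d) (Nat.zero_div d)) (coeff n.1 p)), ?_⟩
      rw [Finsupp.linearCombination_single]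
      change expand d (monomial _ _) * monomial _ 1 = _
      rw [expand_monomial, monomial_mul, mul_one, hn]
    choose v hv using hmon
    refine ⟨∑ n, v n, Subtype.ext ?_⟩
    rw [map_sum]
    change (veronese k d).val (∑ n, L (v n)) = p
    rw [map_sum]
    conv_rhs => rw [p.as_sum, ← Finset.sum_coe_sort]
    exact Finset.sum_congr rfl fun n _ => hv n
  have : Module.Free (MvPolynomial ℕ k) (veronese k d) :=
    Module.Free.of_equiv (LinearEquiv.ofBijective L ⟨hinj, hsurj⟩)
  exact RingHom.flat_algebraMap_iff.2 inferInstance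

theorem hasLongRegularSequences_veronese (hd : 1 ≤ d) :
    HasLongRegularSequences (veronese k d) := by
  intro a n hn
  obtain ⟨rs, hlen, hrs, hreg⟩ := hasLongRegularSequences_mvPolynomial
    (a.comap (toVeronese k d).toRingHom) n
    (hn.trans (height_le_height_comap_of_isIntegral (isIntegral_toVeronese hd) a))
  refine ⟨rs.map (toVeronese k d), by simp [hlen], fun y hy => ?_, ?_⟩
  · obtain ⟨z, hz, rfl⟩ := List.mem_map.1 hy
    exact hrs z hz
  · have hflat := flat_toVeronese (k := k) hd
    algebraize [(toVeronese k d).toRingHom]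
    exact hreg.of_flat

end Veronese

end CohenMacaulay

theorem mainTheorem6 {k : Type*} [Field k] (d : ℕ) (hd : 1 ≤ d) :
    CohenMacaulay.IsCMGlaz (CohenMacaulay.veronese k d) ∧
    CohenMacaulay.IsWeakBourbakiUnmixed (CohenMacaulay.veronese k d) ∧
    CohenMacaulay.IsCMHamiltonMarley (CohenMacaulay.veronese k d) ∧
    (∀ 𝒜 : Set (Ideal (CohenMacaulay.veronese k d)), 𝒜.Nonempty → CohenMacaulay.IsCMClass 𝒜) ∧
    CohenMacaulay.IsCMClass {p : Ideal (CohenMacaulay.veronese k d) | p.IsPrime} ∧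
    CohenMacaulay.IsCMClass {m : Ideal (CohenMacaulay.veronese k d) | m.IsMaximal} ∧
    CohenMacaulay.IsCMClass (Set.univ : Set (Ideal (CohenMacaulay.veronese k d))) ∧
    CohenMacaulay.IsCMClass {a : Ideal (CohenMacaulay.veronese k d) | a.FG} := by
  have h := CohenMacaulay.hasLongRegularSequences_veronese (k := k) hd
  exact ⟨h.isCMGlaz, h.isWeakBourbakiUnmixed, h.isCMHamiltonMarley, fun _ _ => h.isCMClass _,
    h.isCMClass _, h.isCMClass _, h.isCMClass _, h.isCMClass _⟩
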